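/- Let $\mathbb{D}$ be the open unit disc, $dm=\frac1\pi\,dx\,dy$, and let $H(\mathbb{D})$ be the space of analytic functions on $\mathbb{D}$. For an arc $I\subset\partial\mathbb{D}$ of normalized length $|I|\in(0,1]$ put $S(I)=\{z\in\mathbb{D}: 1-|I|\le|z|<1,\ z/|z|\in I\}$ (with $S(\partial\mathbb{D})=\mathbb{D}$) and $f_I=\frac1{|I|}\int_I f(\zeta)\frac{|d\zeta|}{2\pi}$. For $0<\lambda<1$ let $\mathcal{L}^{2,\lambda}$ be the space of all $f$ in the Hardy space $H^2$ whose boundary values satisfy $\sup_I \frac{1}{|I|^{\lambda}}\int_I|f-f_I|^2\frac{|d\zeta|}{2\pi}<\infty$, with norm $$\|f\|_{\mathcal{L}^{2,\lambda}}=|f(0)|+\sup_I\Big(\frac1{|I|^\lambda}\int_{S(I)}|f'(z)|^2(1-|z|^2)\,dm(z)\Big)^{1/2},$$ and let $\mathcal{L}^{2,\lambda}_0$ be the subspace of those $f$ with $\lim_{|I|\to0}\frac1{|I|^\lambda}\int_I|f-f_I|^2\frac{|d\zeta|}{2\pi}=0$. Let $B_0$ be the little Bloch space of all $f\in H(\mathbb{D})$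 with $\sup_{z\in\mathbb{D}}(1-|z|^2)|f'(z)|<\infty$ and $\lim_{|z|\to1^-}(1-|z|^2)|f'(z)|=0$, with norm $|f(0)|+\sup_{z\in\mathbb{D}}(1-|z|^2)|f'(z)|$. For $g\in H(\mathbb{D})$ let $T_gf(z)=\int_0^z f(w)g'(w)\,dw$. The essential norm $\|T\|_{e,X\to Y}$ of a bounded linear operator $T:X\to Y$ is the infimum of $\|T-K\|_{X\to Y}$ over all compact linear operators $K:X\to Y$. **Theorem.** Let $0<\lambda<1$ and $p>1$. There is a constant $C>0$ depending only on $\lambda$ and $p$ such that for every $g\in H(\mathbb{D})$ for which $T_g$ maps $\mathcal{L}^{2,\lambda}_0$ into $B_0$ and is bounded, $$C^{-1}L(g)\le\|T_g\|_{e,\mathcal{L}^{2,\lambda}_0\to B_0}\le C\,L(g),$$ where $$L(g)=\limsup_{|a|\to1^-}\Big(\int_{\mathbb{D}}\Big(\frac{1-|a|^2}{|1-\bar a z|^2}\Big)^{p+1-\lambda}|g'(z)|^2(1-|z|^2)^p\,dm(z)\Big)^{1/2}.$$ -/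

import Mathlib

open MeasureTheory Filter Topology Set
open scoped ENNReal NNReal Real

noncomputable section

/-! ## Analytic functions on the unit disc -/

/-- `H(𝔻)`: analytic functions on the open unit disc. An element is represented by its extension
by zero to `ℂ`, so that two elements are equal iff they agree on the disc. -/
def HolDisc : Submodule ℂ (ℂ → ℂ) where
  carrier := {f | DifferentiableOn ℂ f (Metric.ball 0 1) ∧ ∀ z ∉ Metric.ball (0 : ℂ) 1, f z = 0}
  add_mem' := by
    rintro f h ⟨hf, hf0⟩ ⟨hh, hh0⟩
    exact ⟨hf.add hh, fun z hz => by simp [hf0 z hz, hh0 z hz]⟩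
  zero_mem' := ⟨differentiableOn_const 0, fun _ _ => rfl⟩
  smul_mem' := by
    rintro c f ⟨hf, hf0⟩
    exact ⟨hf.const_smul c, fun z hz => by simp [hf0 z hz]⟩

/-- The filter `|a| → 1⁻` on the disc. -/
def toBoundary : Filter ℂ := comap (fun a : ℂ => ‖a‖) (𝓝[<] (1 : ℝ))

/-- The normalized area measure `dm = π⁻¹ dx dy` on the unit disc. -/
def discMeasure : Measure ℂ := ENNReal.ofReal π⁻¹ • volume.restrict (Metric.ball (0 : ℂ) 1)

/-- The point `r e^{iθ}`. -/
def polarPt (r θ : ℝ) : ℂ := r * Complex.exp (θ * Complex.I)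

/-- `f` (analytic on the disc) belongs to the Hardy space `H²`. -/
def MemH2 (f : ℂ → ℂ) : Prop :=
  (⨆ r ∈ Ioo (0 : ℝ) 1,
    (ENNReal.ofReal (2 * π))⁻¹ * ∫⁻ θ in Ioc (0 : ℝ) (2 * π), ‖f (polarPt r θ)‖ₑ ^ 2) < ∞

/-- `φ`, as a function of the angle, is the boundary function of `f`: it is locally integrable and
`f (r e^{iθ}) → φ θ` as `r → 1⁻`, for almost every `θ`. Such a `φ` is unique up to a null set, and
exists for every `f` in `H²`. -/
def IsBoundaryFn (f : ℂ → ℂ) (φ : ℝ → ℂ) : Prop :=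
  LocallyIntegrable φ ∧ ∀ᵐ θ : ℝ, Tendsto (fun r : ℝ => f (polarPt r θ)) (𝓝[<] 1) (𝓝 (φ θ))

/-! ## Arcs

An arc `I` of the unit circle is given by the angle `c` of its centre and its normalized length
`l ∈ (0, 1]`: it consists of the points `e^{iθ}` with `|θ - c| ≤ π l`. -/

/-- The mean `φ_I = |I|⁻¹ ∫_I φ dθ / 2π`. -/
def arcMean (φ : ℝ → ℂ) (c l : ℝ) : ℂ :=
  ((2 * π * l : ℝ) : ℂ)⁻¹ * ∫ θ in Ioc (c - π * l) (c + π * l), φ θ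

/-- `(|I|^{-λ} ∫_I |φ - φ_I|² dθ / 2π)^{1/2}`. -/
def arcOsc (lam : ℝ) (φ : ℝ → ℂ) (c l : ℝ) : ℝ≥0∞ :=
  ((ENNReal.ofReal (2 * π * l ^ lam))⁻¹ *
    ∫⁻ θ in Ioc (c - π * l) (c + π * l), ‖φ θ - arcMean φ c l‖ₑ ^ 2) ^ (1 / 2 : ℝ)

/-- The Carleson box `S(I) = {z ∈ 𝔻 : 1 - |I| ≤ |z|, z / |z| ∈ I}`. -/
def carlesonBox (c l : ℝ) : Set ℂ :=
  {z | 1 - l ≤ ‖z‖ ∧ ‖z‖ < 1 ∧ ∃ θ ∈ Icc (c - π * l) (c + π * l), z = polarPt ‖z‖ θ}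

/-! ### Helper facts for the subspace structure -/

theorem arcOsc_add_le (lam : ℝ) {φ ψ : ℝ → ℂ} (hφ : LocallyIntegrable φ)
    (hψ : LocallyIntegrable ψ) (c l : ℝ) :
    arcOsc lam (φ + ψ) c l ≤ arcOsc lam φ c l + arcOsc lam ψ c l := by
  have hi : ∀ {χ : ℝ → ℂ}, LocallyIntegrable χ →
      Integrable χ (volume.restrict (Ioc (c - π * l) (c + π * l))) := fun h =>
    (h.integrableOn_isCompact isCompact_Icc).mono_set Ioc_subset_Icc_self
  have hmean : arcMean (φ + ψ) c l = arcMean φ c l + arcMean ψ c l := by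
    unfold arcMean
    rw [← mul_add, ← integral_add (hi hφ) (hi hψ)]
    rfl
  have hm : ∀ {χ : ℝ → ℂ}, LocallyIntegrable χ → AEMeasurable
      (fun θ => ‖χ θ - arcMean χ c l‖ₑ) (volume.restrict (Ioc (c - π * l) (c + π * l))) :=
    fun h => ((hi h).aestronglyMeasurable.sub aestronglyMeasurable_const).enorm
  have key := ENNReal.lintegral_Lp_add_le (hm hφ) (hm hψ) (p := 2) (by norm_num)
  simp only [ENNReal.rpow_two] at key
  unfold arcOsc
  simp only [ENNReal.mul_rpow_of_nonneg _ _ (show (0 : ℝ) ≤ 1 / 2 by norm_num)]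
  rw [← mul_add]
  gcongr
  refine le_trans ?_ key
  gcongr with θ
  rw [hmean]
  simp only [Pi.add_apply]
  rw [add_sub_add_comm]
  exact enorm_add_le _ _

theorem arcOsc_smul (lam : ℝ) (a : ℂ) (φ : ℝ → ℂ) (c l : ℝ) :
    arcOsc lam (a • φ) c l = ‖a‖ₑ * arcOsc lam φ c l := by
  have hmean : arcMean (a • φ) c l = a * arcMean φ c l := by
    unfold arcMean
    simp only [Pi.smul_apply, smul_eq_mul]
    rw [integral_const_mul]
    ring
  unfold arcOsc
  rw [hmean]
  simp only [Pi.smul_apply, smul_eq_mul, ← mul_sub, enorm_mul, mul_pow]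
  rw [lintegral_const_mul' _ _ (by simp), mul_left_comm,
    ENNReal.mul_rpow_of_nonneg _ _ (show (0 : ℝ) ≤ 1 / 2 by norm_num)]
  congr 1
  rw [← ENNReal.rpow_two, ← ENNReal.rpow_mul]
  norm_num

theorem arcOsc_zero (lam c l : ℝ) : arcOsc lam 0 c l = 0 := by
  have h := arcOsc_smul lam 0 0 c l
  simpa using h

theorem MemH2.add {f h : ℂ → ℂ} (hf : f ∈ HolDisc) (hf2 : MemH2 f) (hh2 : MemH2 h) :
    MemH2 (f + h) := by
  unfold MemH2 at *
  refine lt_of_le_of_lt ?_ (ENNReal.mul_lt_top (a := 2) (by simp) (ENNReal.add_lt_top.2 ⟨hf2, hh2⟩))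
  refine iSup₂_le fun r hr => ?_
  refine le_trans ?_ (mul_le_mul_right (add_le_add (le_iSup₂ (f := fun (r : ℝ) (_ : r ∈ Ioo (0 : ℝ) 1)
    => (ENNReal.ofReal (2 * π))⁻¹ * ∫⁻ θ in Ioc (0 : ℝ) (2 * π), ‖f (polarPt r θ)‖ₑ ^ 2) r hr)
    (le_iSup₂ (f := fun (r : ℝ) (_ : r ∈ Ioo (0 : ℝ) 1)
    => (ENNReal.ofReal (2 * π))⁻¹ * ∫⁻ θ in Ioc (0 : ℝ) (2 * π), ‖h (polarPt r θ)‖ₑ ^ 2) r hr)) _)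
  have hc : Continuous fun θ : ℝ => f (polarPt r θ) := by
    refine hf.1.continuousOn.comp_continuous (by unfold polarPt; fun_prop) fun θ => ?_
    have : ‖polarPt r θ‖ = r := by
      simp [polarPt, Complex.norm_exp_ofReal_mul_I, abs_of_pos hr.1]
    simp [this, hr.2]
  rw [← mul_add, mul_left_comm, ← lintegral_add_left (hc.enorm.measurable.pow_const 2),
    ← lintegral_const_mul' 2 _ (by simp)]
  gcongr with θ
  calc ‖(f + h) (polarPt r θ)‖ₑ ^ 2 ≤ (‖f (polarPt r θ)‖ₑ + ‖h (polarPt r θ)‖ₑ) ^ 2 := by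
        gcongr; exact enorm_add_le _ _
    _ ≤ _ := by
        have := ENNReal.rpow_add_le_mul_rpow_add_rpow (‖f (polarPt r θ)‖ₑ) (‖h (polarPt r θ)‖ₑ)
          (p := 2) (by norm_num)
        norm_num [ENNReal.rpow_two] at this
        exact this

theorem MemH2.smul (a : ℂ) {f : ℂ → ℂ} (hf2 : MemH2 f) : MemH2 (a • f) := by
  unfold MemH2 at *
  refine lt_of_le_of_lt ?_ (ENNReal.mul_lt_top (a := ‖a‖ₑ ^ 2) (by simp) hf2)
  refine iSup₂_le fun r hr => ?_
  refine le_trans ?_ (mul_le_mul_right (le_iSup₂ (f := fun (r : ℝ) (_ : r ∈ Ioo (0 : ℝ) 1)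
    => (ENNReal.ofReal (2 * π))⁻¹ * ∫⁻ θ in Ioc (0 : ℝ) (2 * π), ‖f (polarPt r θ)‖ₑ ^ 2) r hr) _)
  rw [mul_left_comm, ← lintegral_const_mul' (‖a‖ₑ ^ 2) _ (by simp)]
  simp only [Pi.smul_apply, smul_eq_mul, enorm_mul, mul_pow, le_refl]

theorem MemH2.zero : MemH2 0 := by simp [MemH2]

theorem IsBoundaryFn.add {f h : ℂ → ℂ} {φ ψ : ℝ → ℂ} (hf : IsBoundaryFn f φ)
    (hh : IsBoundaryFn h ψ) : IsBoundaryFn (f + h) (φ + ψ) :=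
  ⟨hf.1.add hh.1, by filter_upwards [hf.2, hh.2] with θ h1 h2 using h1.add h2⟩

theorem IsBoundaryFn.smul (a : ℂ) {f : ℂ → ℂ} {φ : ℝ → ℂ} (hf : IsBoundaryFn f φ) :
    IsBoundaryFn (a • f) (a • φ) :=
  ⟨hf.1.smul a, by filter_upwards [hf.2] with θ h1 using h1.const_smul a⟩

theorem IsBoundaryFn.zero : IsBoundaryFn 0 0 :=
  ⟨locallyIntegrable_zero, Eventually.of_forall fun _ => tendsto_const_nhds⟩

/-! ## Morrey and Bloch spaces -/

/-- The analytic Morrey space `𝓛^{2,λ}`. -/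
def Morrey (lam : ℝ) : Submodule ℂ (ℂ → ℂ) where
  carrier := {f | f ∈ HolDisc ∧ MemH2 f ∧
    ∃ φ, IsBoundaryFn f φ ∧ (⨆ (c : ℝ) (l ∈ Ioc (0 : ℝ) 1), arcOsc lam φ c l) < ∞}
  add_mem' := by
    rintro f h ⟨hf, hf2, φ, hφ, hφb⟩ ⟨hh, hh2, ψ, hψ, hψb⟩
    refine ⟨add_mem hf hh, hf2.add hf hh2, φ + ψ, hφ.add hψ, ?_⟩
    refine lt_of_le_of_lt ?_ (ENNReal.add_lt_top.2 ⟨hφb, hψb⟩)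
    refine iSup_le fun c => iSup₂_le fun l hl => (arcOsc_add_le lam hφ.1 hψ.1 c l).trans ?_
    gcongr
    · exact le_iSup_of_le c (le_iSup₂_of_le l hl le_rfl)
    · exact le_iSup_of_le c (le_iSup₂_of_le l hl le_rfl)
  zero_mem' := ⟨zero_mem _, MemH2.zero, 0, IsBoundaryFn.zero, by simp [arcOsc_zero]⟩
  smul_mem' := by
    rintro a f ⟨hf, hf2, φ, hφ, hφb⟩
    refine ⟨Submodule.smul_mem _ a hf, hf2.smul a, a • φ, hφ.smul a, ?_⟩
    refine lt_of_le_of_lt ?_ (ENNReal.mul_lt_top (a := ‖a‖ₑ) (by simp) hφb)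
    refine iSup_le fun c => iSup₂_le fun l hl => ?_
    rw [arcOsc_smul]
    gcongr
    exact le_iSup_of_le c (le_iSup₂_of_le l hl le_rfl)

/-- The little analytic Morrey space `𝓛^{2,λ}_0`: the oscillation of the boundary function over an
arc `I` tends to `0` as `|I| → 0`, uniformly in the position of the arc. -/
def LittleMorrey (lam : ℝ) : Submodule ℂ (ℂ → ℂ) where
  carrier := {f | f ∈ Morrey lam ∧ ∃ φ, IsBoundaryFn f φ ∧
    Tendsto (fun I : ℝ × ℝ => arcOsc lam φ I.1 I.2) (comap Prod.snd (𝓝[>] 0)) (𝓝 0)}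
  add_mem' := by
    rintro f h ⟨hf, φ, hφ, hφ0⟩ ⟨hh, ψ, hψ, hψ0⟩
    refine ⟨add_mem hf hh, φ + ψ, hφ.add hψ, ?_⟩
    refine tendsto_of_tendsto_of_tendsto_of_le_of_le tendsto_const_nhds
      (by simpa using hφ0.add hψ0) (fun _ => zero_le) fun I => arcOsc_add_le lam hφ.1 hψ.1 I.1 I.2
  zero_mem' := ⟨zero_mem _, 0, IsBoundaryFn.zero, by simp [arcOsc_zero]⟩
  smul_mem' := by
    rintro a f ⟨hf, φ, hφ, hφ0⟩
    refine ⟨Submodule.smul_mem _ a hf, a • φ, hφ.smul a, ?_⟩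
    simp only [arcOsc_smul]
    simpa using ENNReal.Tendsto.const_mul hφ0 (a := ‖a‖ₑ) (Or.inr (by simp))

/-- The norm of the Morrey space,
`|f(0)| + sup_I (|I|^{-λ} ∫_{S(I)} |f'(z)|² (1 - |z|²) dm(z))^{1/2}`. -/
def morreyNorm (lam : ℝ) (f : ℂ → ℂ) : ℝ≥0∞ :=
  ‖f 0‖ₑ + ⨆ (c : ℝ) (l ∈ Ioc (0 : ℝ) 1),
    ((ENNReal.ofReal (l ^ lam))⁻¹ *
      ∫⁻ z in carlesonBox c l, ENNReal.ofReal (‖deriv f z‖ ^ 2 * (1 - ‖z‖ ^ 2)) ∂discMeasure)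
        ^ (1 / 2 : ℝ)

/-- The norm of the Bloch space, `|f(0)| + sup_{z ∈ 𝔻} (1 - |z|²) |f'(z)|`. -/
def blochNorm (f : ℂ → ℂ) : ℝ≥0∞ :=
  ‖f 0‖ₑ + ⨆ z ∈ Metric.ball (0 : ℂ) 1, ENNReal.ofReal ((1 - ‖z‖ ^ 2) * ‖deriv f z‖)

theorem HolDisc.differentiableAt {f : ℂ → ℂ} (hf : f ∈ HolDisc) {z : ℂ}
    (hz : z ∈ Metric.ball (0 : ℂ) 1) : DifferentiableAt ℂ f z :=
  hf.1.differentiableAt (Metric.isOpen_ball.mem_nhds hz)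

theorem blochNorm_add_le {f h : ℂ → ℂ} (hf : f ∈ HolDisc) (hh : h ∈ HolDisc) :
    blochNorm (f + h) ≤ blochNorm f + blochNorm h := by
  unfold blochNorm
  rw [add_add_add_comm]
  refine add_le_add (enorm_add_le _ _) (iSup₂_le fun z hz => ?_)
  have hz1 : 0 ≤ 1 - ‖z‖ ^ 2 := by
    have : ‖z‖ < 1 := by simpa using hz
    nlinarith [norm_nonneg z]
  rw [deriv_add (HolDisc.differentiableAt hf hz) (HolDisc.differentiableAt hh hz)]
  refine le_trans (ENNReal.ofReal_le_ofReal
    (mul_le_mul_of_nonneg_left (norm_add_le _ _) hz1)) ?_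
  rw [mul_add, ENNReal.ofReal_add (by positivity) (by positivity)]
  exact add_le_add
    (le_iSup₂ (f := fun z (_ : z ∈ Metric.ball (0 : ℂ) 1) =>
      ENNReal.ofReal ((1 - ‖z‖ ^ 2) * ‖deriv f z‖)) z hz)
    (le_iSup₂ (f := fun z (_ : z ∈ Metric.ball (0 : ℂ) 1) =>
      ENNReal.ofReal ((1 - ‖z‖ ^ 2) * ‖deriv h z‖)) z hz)

theorem blochNorm_smul_le (a : ℂ) {f : ℂ → ℂ} (hf : f ∈ HolDisc) :
    blochNorm (a • f) ≤ ‖a‖ₑ * blochNorm f := by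
  unfold blochNorm
  rw [mul_add]
  refine add_le_add (by simp) (iSup₂_le fun z hz => ?_)
  rw [deriv_const_smul a (HolDisc.differentiableAt hf hz), norm_smul, mul_left_comm,
    ENNReal.ofReal_mul (norm_nonneg _), ofReal_norm]
  gcongr
  exact le_iSup₂ (f := fun z (_ : z ∈ Metric.ball (0 : ℂ) 1) =>
      ENNReal.ofReal ((1 - ‖z‖ ^ 2) * ‖deriv f z‖)) z hz

theorem eventually_toBoundary_mem_ball : ∀ᶠ z in toBoundary, z ∈ Metric.ball (0 : ℂ) 1 := by
  have h : ∀ᶠ x in 𝓝[<] (1 : ℝ), x < 1 := eventually_mem_nhdsWithin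
  filter_upwards [h.comap (fun a : ℂ => ‖a‖)] with z hz
  simpa using hz

/-- The Bloch space `B`. -/
def Bloch : Submodule ℂ (ℂ → ℂ) where
  carrier := {f | f ∈ HolDisc ∧ blochNorm f < ∞}
  add_mem' := by
    rintro f h ⟨hf, hf1⟩ ⟨hh, hh1⟩
    exact ⟨add_mem hf hh, (blochNorm_add_le hf hh).trans_lt (ENNReal.add_lt_top.2 ⟨hf1, hh1⟩)⟩
  zero_mem' := ⟨zero_mem _, by simp [blochNorm]⟩
  smul_mem' := by
    rintro a f ⟨hf, hf1⟩
    exact ⟨Submodule.smul_mem _ a hf,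
      (blochNorm_smul_le a hf).trans_lt (ENNReal.mul_lt_top (by simp) hf1)⟩

/-- The little Bloch space `B_0`. -/
def LittleBloch : Submodule ℂ (ℂ → ℂ) where
  carrier := {f | f ∈ Bloch ∧
    Tendsto (fun z : ℂ => (1 - ‖z‖ ^ 2) * ‖deriv f z‖) toBoundary (𝓝 0)}
  add_mem' := by
    rintro f h ⟨hf, hf0⟩ ⟨hh, hh0⟩
    refine ⟨add_mem hf hh, ?_⟩
    have hlim := hf0.add hh0
    rw [add_zero] at hlim
    refine squeeze_zero' ?_ ?_ hlim
    all_goals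
      filter_upwards [eventually_toBoundary_mem_ball] with z hz
      have hz1 : 0 ≤ 1 - ‖z‖ ^ 2 := by
        have : ‖z‖ < 1 := by simpa using hz
        nlinarith [norm_nonneg z]
    · positivity
    · rw [deriv_add (HolDisc.differentiableAt hf.1 hz) (HolDisc.differentiableAt hh.1 hz),
        ← mul_add]
      exact mul_le_mul_of_nonneg_left (norm_add_le _ _) hz1
  zero_mem' := ⟨zero_mem _, by
    have h : (fun z : ℂ => (1 - ‖z‖ ^ 2) * ‖deriv (0 : ℂ → ℂ) z‖) = fun _ => 0 := by
      funext z; simp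
    rw [h]
    exact tendsto_const_nhds⟩
  smul_mem' := by
    rintro a f ⟨hf, hf0⟩
    refine ⟨Submodule.smul_mem _ a hf, ?_⟩
    have hlim := hf0.const_mul ‖a‖
    rw [mul_zero] at hlim
    refine hlim.congr' ?_
    filter_upwards [eventually_toBoundary_mem_ball] with z hz
    rw [deriv_const_smul a (HolDisc.differentiableAt hf.1 hz), norm_smul]
    ring

/-! ## The Volterra-type operator -/

open Classical in
/-- `T_g f (z) = ∫_0^z f(w) g'(w) dw`, the integral being taken along the segment `[0, z]`
(the integrand is analytic on the disc, so the path is immaterial). -/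
def volterra (g f : ℂ → ℂ) (z : ℂ) : ℂ :=
  if z ∈ Metric.ball (0 : ℂ) 1 then ∫ t in (0 : ℝ)..1, f (t * z) * deriv g (t * z) * z else 0

theorem volterra_integrable {g f : ℂ → ℂ} (hg : DifferentiableOn ℂ g (Metric.ball 0 1))
    (hf : f ∈ HolDisc) {z : ℂ} (hz : z ∈ Metric.ball (0 : ℂ) 1) :
    IntervalIntegrable (fun t : ℝ => f (t * z) * deriv g (t * z) * z) volume 0 1 := by
  have hmaps : MapsTo (fun t : ℝ => (t : ℂ) * z) (uIcc 0 1) (Metric.ball 0 1) := by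
    intro t ht
    rw [uIcc_of_le zero_le_one] at ht
    have h1 : ‖z‖ < 1 := by simpa using hz
    have : |t| * ‖z‖ < 1 := by
      rw [abs_of_nonneg ht.1]
      nlinarith [ht.1, ht.2, norm_nonneg z]
    simpa using this
  have hseg : ContinuousOn (fun t : ℝ => (t : ℂ) * z) (uIcc 0 1) := by fun_prop
  exact (((hf.1.continuousOn.comp hseg hmaps).mul
    ((hg.deriv Metric.isOpen_ball).continuousOn.comp hseg hmaps)).mul
      continuousOn_const).intervalIntegrable

/-- `T_g` as a linear operator `𝓛^{2,λ}_0 → B_0`, when it maps the first space into the second. -/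
def volterraOp (lam : ℝ) {g : ℂ → ℂ} (hg : DifferentiableOn ℂ g (Metric.ball 0 1))
    (hmap : ∀ f ∈ LittleMorrey lam, volterra g f ∈ LittleBloch) :
    LittleMorrey lam →ₗ[ℂ] LittleBloch where
  toFun f := ⟨volterra g f, hmap f f.2⟩
  map_add' := by
    rintro ⟨f, hf⟩ ⟨h, hh⟩
    ext z
    simp only [volterra, Pi.add_apply, AddMemClass.mk_add_mk]
    split_ifs with hz
    · rw [← intervalIntegral.integral_add (volterra_integrable hg hf.1.1 hz)
        (volterra_integrable hg hh.1.1 hz)]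
      simp only [add_mul]
    · simp
  map_smul' := by
    rintro a ⟨f, hf⟩
    ext z
    simp only [volterra, SetLike.mk_smul_mk, Pi.smul_apply, RingHom.id_apply,
      smul_eq_mul]
    split_ifs with hz
    · rw [← intervalIntegral.integral_const_mul]
      simp only [mul_assoc]
    · simp

/-! ## Operator norm, compact operators, essential norm

Here `X`, `Y` are linear spaces of functions with norms `NX`, `NY`. -/

/-- The operator norm `sup {‖T f‖ : ‖f‖ ≤ 1}`. -/
def opNormOf (NX NY : (ℂ → ℂ) → ℝ≥0∞) {X Y : Submodule ℂ (ℂ → ℂ)} (T : X →ₗ[ℂ] Y) : ℝ≥0∞ :=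
  ⨆ (f : X) (_ : NX f ≤ 1), NY (T f)

/-- `K` is compact: the image of every sequence in the unit ball has a subsequence that converges
in `Y`. -/
def IsCompactOp (NX NY : (ℂ → ℂ) → ℝ≥0∞) {X Y : Submodule ℂ (ℂ → ℂ)} (K : X →ₗ[ℂ] Y) : Prop :=
  ∀ u : ℕ → X, (∀ n, NX (u n) ≤ 1) →
    ∃ (h : Y) (s : ℕ → ℕ), StrictMono s ∧
      Tendsto (fun k => NY (K (u (s k)) - h)) atTop (𝓝 0)

/-- The essential norm: the distance, in operator norm, to the compact operators. -/
def essNormOf (NX NY : (ℂ → ℂ) → ℝ≥0∞) {X Y : Submodule ℂ (ℂ → ℂ)} (T : X →ₗ[ℂ] Y) : ℝ≥0∞ :=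
  ⨅ (K : X →ₗ[ℂ] Y) (_ : IsCompactOp NX NY K), opNormOf NX NY (T - K)

/-- `(∫_𝔻 ((1-|a|²)/|1-āz|²)^{p+1-λ} |g'(z)|² (1-|z|²)^p dm(z))^{1/2}`. -/
def blochMorreyIntegral (p lam : ℝ) (g : ℂ → ℂ) (a : ℂ) : ℝ≥0∞ :=
  (∫⁻ z, ENNReal.ofReal (((1 - ‖a‖ ^ 2) / ‖1 - (starRingEnd ℂ) a * z‖ ^ 2) ^ (p + 1 - lam) *
    ‖deriv g z‖ ^ 2 * (1 - ‖z‖ ^ 2) ^ p) ∂discMeasure) ^ (1 / 2 : ℝ)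

end

/-! Both sides are comparable to a third quantity, W = limsup of (1-|z|²)^{(1+λ)/2}|g'(z)| as |z| →
1. It arises because (T_g f)' = f g', and the largest value of |f(a)| over the unit ball of the
Morrey space has order (1-|a|)^{-(1-λ)/2}.

W and L(g). The sub-mean value property of |g'|² on the disc of radius (1-|a|)/2 about `a` bounds
the weight at `a` by the integral at `a` (`blochMorreyWeight_le_blochMorreyIntegral`). Conversely,
near the circle |g'|²(1-|z|²)^p is at most a constant times (1-|z|²)^{p-1-λ}. The kernel exponent
p+1-λ exceeds p-1-λ by exactly 2, so the disc automorphism exchanging 0 and `a` turns that part of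
the integral into one independent of `a`; the part over a fixed smaller disc tends to 0
(`limsup_blochMorreyIntegral_le`).

W bounded by the essential norm. The functions (1-āz)^{-(1-λ)/2} have bounded Morrey norm and the
extremal size at `a`. If K is compact, a subsequence of their images under K converges to some h in
B_0, and (1-|a|²)|h'(a)| → 0. So K contributes nothing at the points `a` in the limit, and no weak
convergence of the test functions is needed (`limsup_blochMorreyWeight_le_essNorm`).

Essential norm bounded by W. Let P f be a Taylor polynomial of z ↦ f(rz). Then T_g ∘ P has finite
rank, hence is compact. The remainder f - P f is uniformly small on a given disc |z| ≤ R and keeps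
the growth bound (1-|z|)^{-(1-λ)/2} outside it, where the weight is already close to W or below
(`essNorm_le_limsup_blochMorreyWeight`). -/

/-! ### Disc automorphisms and conformal change of variables -/

/-- The real Jacobian of an analytic map is |F'|²: the determinant of multiplication by c is the
norm of c in the extension ℂ/ℝ. -/
theorem lintegral_image_eq_lintegral_normSq_deriv_mul {s : Set ℂ} (hs : MeasurableSet s)
    {F F' : ℂ → ℂ} (hF : ∀ z ∈ s, HasDerivAt F (F' z) z) (hinj : InjOn F s) (G : ℂ → ℝ≥0∞) :
    ∫⁻ z in F '' s, G z = ∫⁻ z in s, ENNReal.ofReal (‖F' z‖ ^ 2) * G (F z) := by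
  have hdet : ∀ c : ℂ, |(((ContinuousLinearMap.toSpanSingleton ℂ c : ℂ →L[ℂ] ℂ).restrictScalars
      ℝ)).det| = ‖c‖ ^ 2 := by
    intro c
    have h1 : ((((ContinuousLinearMap.toSpanSingleton ℂ c : ℂ →L[ℂ] ℂ).restrictScalars
      ℝ)) : ℂ →ₗ[ℝ] ℂ) = LinearMap.mul ℝ ℂ c := by
      ext x; simp [mul_comm]
    rw [ContinuousLinearMap.det, h1]
    have h2 := Algebra.norm_complex_apply c
    rw [Algebra.norm_apply] at h2
    have h3 : LinearMap.mul ℝ ℂ c = Algebra.lmul ℝ ℂ c := rfl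
    rw [h3, h2, Complex.normSq_eq_norm_sq, abs_of_nonneg (by positivity)]
  rw [lintegral_image_eq_lintegral_abs_det_fderiv_mul volume hs
    (fun z hz => ((hF z hz).hasFDerivAt.restrictScalars ℝ).hasFDerivWithinAt) hinj]
  simp only [hdet]

theorem one_sub_conj_mul_ne_zero {a z : ℂ} (ha : ‖a‖ < 1) (hz : ‖z‖ ≤ 1) :
    1 - (starRingEnd ℂ) a * z ≠ 0 := by
  intro h
  have h1 : ‖(starRingEnd ℂ) a * z‖ = 1 := by rw [← sub_eq_zero.1 h]; simp
  rw [norm_mul, RCLike.norm_conj] at h1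
  nlinarith [norm_nonneg a, norm_nonneg z]

theorem one_sub_le_norm_one_sub_conj_mul {a z : ℂ} (ha : ‖a‖ ≤ 1) :
    1 - ‖z‖ ≤ ‖1 - (starRingEnd ℂ) a * z‖ := by
  have h := norm_sub_norm_le (1 : ℂ) ((starRingEnd ℂ) a * z)
  rw [norm_mul, RCLike.norm_conj, norm_one] at h
  nlinarith [norm_nonneg a, norm_nonneg z]

/-- The involutive automorphism of the disc exchanging `0` and `a`. -/
noncomputable def discInvolution (a z : ℂ) : ℂ := (a - z) / (1 - (starRingEnd ℂ) a * z)

theorem one_sub_normSq_discInvolution {a z : ℂ} (ha : ‖a‖ < 1) (hz : ‖z‖ < 1) :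
    1 - ‖discInvolution a z‖ ^ 2 =
      (1 - ‖a‖ ^ 2) / ‖1 - (starRingEnd ℂ) a * z‖ ^ 2 * (1 - ‖z‖ ^ 2) := by
  have h0 := norm_pos_iff.2 (one_sub_conj_mul_ne_zero ha hz.le)
  rw [discInvolution, norm_div, div_pow, div_mul_eq_mul_div, eq_div_iff (by positivity), sub_mul,
    div_mul_cancel₀ _ (by positivity)]
  simp only [← Complex.normSq_eq_norm_sq, Complex.normSq_apply, Complex.sub_re, Complex.sub_im,
    Complex.mul_re, Complex.mul_im, Complex.conj_re, Complex.conj_im, Complex.one_re,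
    Complex.one_im]
  ring

theorem norm_discInvolution_lt {a z : ℂ} (ha : ‖a‖ < 1) (hz : ‖z‖ < 1) :
    ‖discInvolution a z‖ < 1 := by
  have h := one_sub_normSq_discInvolution ha hz
  have h0 := norm_pos_iff.2 (one_sub_conj_mul_ne_zero ha hz.le)
  have h1 : 0 < 1 - ‖a‖ ^ 2 := by nlinarith [norm_nonneg a]
  have h2 : 0 < 1 - ‖z‖ ^ 2 := by nlinarith [norm_nonneg z]
  have h3 : 0 < 1 - ‖discInvolution a z‖ ^ 2 := by rw [h]; positivity
  nlinarith [norm_nonneg (discInvolution a z)]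

theorem discInvolution_discInvolution {a z : ℂ} (ha : ‖a‖ < 1) (hz : ‖z‖ < 1) :
    discInvolution a (discInvolution a z) = z := by
  have h0 := one_sub_conj_mul_ne_zero ha hz.le
  have h1 : 1 - (starRingEnd ℂ) a * a ≠ 0 := one_sub_conj_mul_ne_zero ha ha.le
  unfold discInvolution
  generalize (starRingEnd ℂ) a = b at h0 h1 ⊢
  have e1 : a - (a - z) / (1 - b * z) = z * (1 - b * a) / (1 - b * z) := by
    rw [eq_div_iff h0, sub_mul, div_mul_cancel₀ _ h0]; ring
  have e2 : 1 - b * ((a - z) / (1 - b * z)) = (1 - b * a) / (1 - b * z) := by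
    rw [eq_div_iff h0, sub_mul, mul_assoc, div_mul_cancel₀ _ h0]; ring
  rw [e1, e2, div_div_div_cancel_right₀ h0, mul_div_cancel_right₀ _ h1]

theorem hasDerivAt_discInvolution {a z : ℂ} (ha : ‖a‖ < 1) (hz : ‖z‖ < 1) :
    HasDerivAt (discInvolution a)
      (-(1 - (starRingEnd ℂ) a * a) / (1 - (starRingEnd ℂ) a * z) ^ 2) z := by
  have h0 := one_sub_conj_mul_ne_zero ha hz.le
  have h := ((hasDerivAt_id z).const_sub a).div
    (((hasDerivAt_id z).const_mul ((starRingEnd ℂ) a)).const_sub 1) h0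
  refine h.congr_deriv ?_
  simp only [id]
  ring

/-- Substitution by `discInvolution a`. With κ = (1-|a|²)/|1-āz|², the weight 1-|z|² becomes
κ(1-|z|²) and the Jacobian is κ², which accounts for the exponent q+2. -/
theorem lintegral_ball_eq_lintegral_mobius (q : ℝ) {a : ℂ} (ha : ‖a‖ < 1) :
    ∫⁻ z in Metric.ball (0 : ℂ) 1, ENNReal.ofReal ((1 - ‖z‖ ^ 2) ^ q) =
      ∫⁻ z in Metric.ball (0 : ℂ) 1,
        ENNReal.ofReal (((1 - ‖a‖ ^ 2) / ‖1 - (starRingEnd ℂ) a * z‖ ^ 2) ^ (q + 2) *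
          (1 - ‖z‖ ^ 2) ^ q) := by
  have hball : ∀ {z : ℂ}, z ∈ Metric.ball (0 : ℂ) 1 ↔ ‖z‖ < 1 := by simp
  have himg : discInvolution a '' Metric.ball (0 : ℂ) 1 = Metric.ball (0 : ℂ) 1 := by
    ext z
    constructor
    · rintro ⟨w, hw, rfl⟩
      exact hball.2 (norm_discInvolution_lt ha (hball.1 hw))
    · intro hz
      exact ⟨discInvolution a z, hball.2 (norm_discInvolution_lt ha (hball.1 hz)),
        discInvolution_discInvolution ha (hball.1 hz)⟩
  have hinj : InjOn (discInvolution a) (Metric.ball (0 : ℂ) 1) := by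
    intro z hz w hw h
    rw [← discInvolution_discInvolution ha (hball.1 hz), h,
      discInvolution_discInvolution ha (hball.1 hw)]
  conv_lhs => rw [← himg]
  rw [lintegral_image_eq_lintegral_normSq_deriv_mul Metric.isOpen_ball.measurableSet
    (fun z hz => hasDerivAt_discInvolution ha (hball.1 hz)) hinj]
  refine setLIntegral_congr_fun Metric.isOpen_ball.measurableSet fun z hz => ?_
  have hz := hball.1 hz
  have h0 := norm_pos_iff.2 (one_sub_conj_mul_ne_zero ha hz.le)
  have h1 : 0 < 1 - ‖a‖ ^ 2 := by nlinarith [norm_nonneg a]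
  have h2 : 0 < 1 - ‖z‖ ^ 2 := by nlinarith [norm_nonneg z]
  have h3 : ‖1 - (starRingEnd ℂ) a * a‖ = 1 - ‖a‖ ^ 2 := by
    rw [← Complex.normSq_eq_conj_mul_self, Complex.normSq_eq_norm_sq, ← Complex.ofReal_one,
      ← Complex.ofReal_sub, Complex.norm_real, Real.norm_of_nonneg h1.le]
  rw [← ENNReal.ofReal_mul (by positivity), one_sub_normSq_discInvolution ha hz,
    Real.mul_rpow (by positivity) h2.le, Real.rpow_add (by positivity), Real.rpow_two, norm_div,
    norm_neg, h3, norm_pow]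
  ring_nf

/-! ### Convergent radial integrals and the sub-mean value property -/

theorem lintegral_ball_one_sub_normSq_rpow_lt_top {q : ℝ} (hq : -1 < q) :
    ∫⁻ z in Metric.ball (0 : ℂ) 1, ENNReal.ofReal ((1 - ‖z‖ ^ 2) ^ q) < ∞ := by
  have h : IntegrableOn (fun z : ℂ => (fun x : ℝ => (1 - x ^ 2) ^ q) ‖z‖)
      (Metric.ball (0 : ℂ) 1) := by
    refine (integrableOn_fun_norm_addHaar (E := ℂ) volume
      (f := fun x : ℝ => (1 - x ^ 2) ^ q)).2 ?_
    simp only [Complex.finrank_real_complex, smul_eq_mul]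
    have h1 : IntegrableOn (fun x : ℝ => (1 - x) ^ q) (Ioo 0 1) := by
      have := (intervalIntegral.intervalIntegrable_rpow' (a := 0) (b := 1) hq).comp_sub_left 1
      simp only [sub_zero, sub_self] at this
      have h2 := this.symm
      rw [intervalIntegrable_iff_integrableOn_Ioo_of_le zero_le_one] at h2
      exact h2
    refine (h1.const_mul (2 ^ |q|)).mono' ?_ ?_
    · refine Measurable.aestronglyMeasurable ?_
      fun_prop
    · refine (ae_restrict_iff' measurableSet_Ioo).2 (Eventually.of_forall fun x hx => ?_)
      have h3 : (0 : ℝ) < 1 - x := by linarith [hx.2]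
      have h4 : (0 : ℝ) < 1 + x := by linarith [hx.1]
      -- In 1-x² = (1-x)(1+x) only the first factor is singular; |q| covers both signs of q.
      have h5 : (1 + x) ^ q ≤ 2 ^ |q| :=
        (Real.rpow_le_rpow_of_exponent_le (by linarith [hx.1]) (le_abs_self q)).trans
          (Real.rpow_le_rpow h4.le (by linarith [hx.2]) (abs_nonneg q))
      rw [show 1 - x ^ 2 = (1 - x) * (1 + x) by ring, Real.mul_rpow h3.le h4.le,
        Real.norm_of_nonneg (by have := hx.1.le; positivity)]
      have h6 : 0 < (1 - x) ^ q := by positivity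
      have h7 : x ^ (2 - 1) ≤ 1 := by simpa using hx.2.le
      calc x ^ (2 - 1) * ((1 - x) ^ q * (1 + x) ^ q) ≤ 1 * ((1 - x) ^ q * 2 ^ |q|) := by gcongr
        _ = _ := by ring
  have h2 := h.2
  rw [hasFiniteIntegral_iff_enorm] at h2
  refine lt_of_le_of_lt (lintegral_mono fun z => ?_) h2
  exact Real.ofReal_le_enorm _

theorem lintegral_ball_norm_rpow_lt_top {α : ℝ} (hα : -2 < α) :
    ∫⁻ z in Metric.ball (0 : ℂ) 1, ENNReal.ofReal (‖z‖ ^ α) < ∞ := by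
  have h : IntegrableOn (fun z : ℂ => ‖z‖ ^ α) (Metric.ball (0 : ℂ) 1) := by
    refine integrableOn_ball_of_norm_le_rpow (C := 1) (α := -α) (by simp) (by simp; linarith)
      (Eventually.of_forall fun z => ?_) (Measurable.aestronglyMeasurable (by fun_prop))
    rw [neg_neg, one_mul, Real.norm_of_nonneg (by positivity)]
  have h2 := h.2
  rw [hasFiniteIntegral_iff_enorm] at h2
  exact lt_of_le_of_lt (lintegral_mono fun z => Real.ofReal_le_enorm _) h2

/-- The sub-mean value property of `‖h‖ ^ 2` on discs. -/
theorem normSq_center_le_lintegral_ball {h : ℂ → ℂ} {a : ℂ} {r : ℝ} (hr : 0 ≤ r)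
    (hh : DifferentiableOn ℂ h (Metric.ball a r)) :
    ENNReal.ofReal (π * r ^ 2) * ‖h a‖ₑ ^ 2 ≤ ∫⁻ z in Metric.ball a r, ‖h z‖ₑ ^ 2 := by
  set G : ℂ → ℝ≥0∞ := (Metric.ball a r).indicator fun z => ‖h z‖ₑ ^ 2 with hG
  have hGm : Measurable G := by
    classical
    have h1 : G = (Metric.ball a r).piecewise (fun z => ‖h z‖ₑ ^ 2) fun _ => 0 :=
      Set.piecewise_eq_indicator.symm
    rw [h1]
    refine ContinuousOn.measurable_piecewise ?_ continuousOn_const Metric.isOpen_ball.measurableSet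
    exact (ENNReal.continuous_pow 2).comp_continuousOn hh.continuousOn.enorm
  have hcirc : ∀ ρ ∈ Ioo 0 r, ENNReal.ofReal (2 * π) * ‖h a‖ₑ ^ 2 ≤
      ∫⁻ θ in Ioo (-π) π, G (Complex.polarCoord.symm (ρ, θ) + a) := by
    intro ρ hρ
    have hmap : ∀ θ : ℝ, circleMap a ρ θ = Complex.polarCoord.symm (ρ, θ) + a := fun θ => by
      rw [Complex.polarCoord_symm_apply, circleMap, Complex.exp_mul_I, add_comm]
      push_cast
      rfl
    have hmem : ∀ θ : ℝ, circleMap a ρ θ ∈ Metric.ball a r := fun θ => by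
      simp [circleMap, dist_eq_norm, abs_of_pos hρ.1, hρ.2]
    -- Averaging the analytic function h² gives an equality; taking norms inside the integral then
    -- gives the inequality for |h|².
    have hav := DiffContOnCl.circleAverage (f := fun z => h z ^ 2) (c := a) (R := ρ)
      (((hh.pow 2).mono (by
        rw [abs_of_pos hρ.1]
        exact Metric.closedBall_subset_ball hρ.2)).diffContOnCl_ball subset_rfl)
    rw [Real.circleAverage_eq_integral_add (-π), intervalIntegral.integral_comp_add_right
      (fun θ => h (circleMap a ρ θ) ^ 2), zero_add, show 2 * π + -π = π by ring,
      inv_smul_eq_iff₀ (by positivity)] at hav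
    have h2 : ENNReal.ofReal (2 * π) * ‖h a‖ₑ ^ 2 = ‖(2 * π) • h a ^ 2‖ₑ := by
      rw [enorm_smul, enorm_pow, Real.enorm_of_nonneg (by positivity)]
    rw [h2, ← hav, intervalIntegral.integral_of_le (by linarith [Real.pi_pos]),
      integral_Ioc_eq_integral_Ioo]
    refine (enorm_integral_le_lintegral_enorm _).trans (lintegral_mono fun θ => ?_)
    rw [← hmap, hG, indicator_of_mem (hmem θ), enorm_pow]
  calc ENNReal.ofReal (π * r ^ 2) * ‖h a‖ₑ ^ 2
      = ∫⁻ ρ in Ioo 0 r, ENNReal.ofReal ρ * (ENNReal.ofReal (2 * π) * ‖h a‖ₑ ^ 2) := by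
        have h3 : ∫⁻ ρ in Ioo 0 r, ENNReal.ofReal ρ = ENNReal.ofReal (r ^ 2 / 2) := by
          have h4 : IntegrableOn (fun ρ : ℝ => ρ) (Ioc 0 r) :=
            (continuous_id.integrableOn_Icc).mono_set Ioc_subset_Icc_self
          rw [setLIntegral_congr Ioo_ae_eq_Ioc, ← ofReal_integral_eq_lintegral_ofReal h4
            ((ae_restrict_iff' measurableSet_Ioc).2 (Eventually.of_forall fun x hx => hx.1.le)),
            ← intervalIntegral.integral_of_le hr, integral_id]
          simp
        rw [lintegral_mul_const' _ _ (by finiteness), h3, ← mul_assoc,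
          ← ENNReal.ofReal_mul (by positivity)]
        ring_nf
    _ ≤ ∫⁻ ρ in Ioo 0 r, ENNReal.ofReal ρ *
          ∫⁻ θ in Ioo (-π) π, G (Complex.polarCoord.symm (ρ, θ) + a) :=
        setLIntegral_mono' measurableSet_Ioo fun ρ hρ => by gcongr; exact hcirc ρ hρ
    _ ≤ ∫⁻ ρ in Ioi 0, ENNReal.ofReal ρ *
          ∫⁻ θ in Ioo (-π) π, G (Complex.polarCoord.symm (ρ, θ) + a) :=
        lintegral_mono_set Ioo_subset_Ioi_self
    _ = ∫⁻ p in polarCoord.target, ENNReal.ofReal p.1 •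
          G (Complex.polarCoord.symm p + a) := by
        have hm : Measurable fun p : ℝ × ℝ => G (Complex.polarCoord.symm p + a) := by
          have h1 : Measurable fun p : ℝ × ℝ => Complex.polarCoord.symm p := by
            simp only [Complex.polarCoord_symm_apply]
            fun_prop
          exact hGm.comp (h1.add_const a)
        rw [polarCoord_target, Measure.volume_eq_prod, ← Measure.prod_restrict,
          lintegral_prod _ (Measurable.aemeasurable (by
            exact (by fun_prop : Measurable fun p : ℝ × ℝ => ENNReal.ofReal p.1).mul hm))]
        refine lintegral_congr fun ρ => ?_
        simp only [smul_eq_mul]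
        rw [lintegral_const_mul' _ _ ENNReal.ofReal_ne_top]
    _ = ∫⁻ z, G z := by
        rw [Complex.lintegral_comp_polarCoord_symm (fun z => G (z + a)),
          lintegral_add_right_eq_self]
    _ = ∫⁻ z in Metric.ball a r, ‖h z‖ₑ ^ 2 := by
        rw [hG, lintegral_indicator Metric.isOpen_ball.measurableSet]

/-! ### Functions analytic across the circle -/

theorem norm_polarPt (r θ : ℝ) : ‖polarPt r θ‖ = |r| := by
  simp [polarPt, Complex.norm_exp_ofReal_mul_I]

theorem continuous_polarPt_right (r : ℝ) : Continuous (polarPt r) := by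
  unfold polarPt; fun_prop

theorem dist_polarPt_le (r x y : ℝ) : ‖polarPt r x - polarPt r y‖ ≤ |r| * |x - y| := by
  have h : polarPt r x - polarPt r y =
      r * (Complex.exp (y * Complex.I) * (Complex.exp (Complex.I * ((x - y : ℝ) : ℂ)) - 1)) := by
    rw [mul_sub, ← Complex.exp_add, polarPt, polarPt]
    push_cast
    ring_nf
  rw [h, norm_mul, norm_mul, Complex.norm_real, Complex.norm_exp_ofReal_mul_I, one_mul,
    Real.norm_eq_abs]
  gcongr
  exact Real.norm_exp_I_mul_ofReal_sub_one_le

/-- On an interval of length 2πl, φ differs from its mean by at most 2πKl, and dividing by l^λ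
instead of l costs nothing since l ≤ l^λ. The factor l yields both the uniform bound and the decay
for short arcs. -/
theorem arcOsc_le_of_lipschitz {lam : ℝ} (hlam : lam < 1) {φ : ℝ → ℂ} {K : ℝ} (hK : 0 ≤ K)
    (hφ : ∀ x y, ‖φ x - φ y‖ ≤ K * |x - y|) (c : ℝ) {l : ℝ} (hl : l ∈ Ioc (0 : ℝ) 1) :
    arcOsc lam φ c l ≤ ENNReal.ofReal (2 * π * K * l) := by
  have hl0 := hl.1
  have hpi := Real.pi_pos
  have hcont : Continuous φ :=
    (LipschitzWith.of_dist_le_mul (K := ⟨K, hK⟩) fun x y => by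
      rw [dist_eq_norm, Real.dist_eq]; exact hφ x y).continuous
  have hlen : c + π * l - (c - π * l) = 2 * π * l := by ring
  have hle : c - π * l ≤ c + π * l := by nlinarith
  have hvol : volume (Ioc (c - π * l) (c + π * l)) = ENNReal.ofReal (2 * π * l) := by
    rw [Real.volume_Ioc, hlen]
  have hmean : ∀ x ∈ Ioc (c - π * l) (c + π * l), ‖φ x - arcMean φ c l‖ ≤ 2 * π * K * l := by
    intro x hx
    have hI : φ x - arcMean φ c l =
        ((2 * π * l : ℝ) : ℂ)⁻¹ * ∫ θ in Ioc (c - π * l) (c + π * l), (φ x - φ θ) := by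
      rw [integral_sub (by simp) (hcont.integrableOn_Icc.mono_set Ioc_subset_Icc_self), mul_sub,
        setIntegral_const, measureReal_def, hvol, ENNReal.toReal_ofReal (by positivity),
        Complex.real_smul, inv_mul_cancel_left₀ (by
          rw [Complex.ofReal_ne_zero]; positivity), arcMean]
    have hb : ‖∫ θ in Ioc (c - π * l) (c + π * l), (φ x - φ θ)‖ ≤
        (K * (2 * π * l)) * (2 * π * l) := by
      have := norm_setIntegral_le_of_norm_le_const (μ := volume)
        (s := Ioc (c - π * l) (c + π * l)) (f := fun θ => φ x - φ θ) (C := K * (2 * π * l))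
        (by simp [hvol]) (fun θ hθ => (hφ x θ).trans (by
          gcongr
          rw [abs_le]
          constructor <;> linarith [hx.1, hx.2, hθ.1, hθ.2]))
      rwa [measureReal_def, hvol, ENNReal.toReal_ofReal (by positivity)] at this
    rw [hI, norm_mul, norm_inv, Complex.norm_real, Real.norm_of_nonneg (by positivity),
      inv_mul_le_iff₀ (by positivity)]
    linarith
  have hint : ∫⁻ θ in Ioc (c - π * l) (c + π * l), ‖φ θ - arcMean φ c l‖ₑ ^ 2 ≤
      ENNReal.ofReal ((2 * π * K * l) ^ 2 * (2 * π * l)) := by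
    calc _ ≤ ∫⁻ θ in Ioc (c - π * l) (c + π * l), ENNReal.ofReal ((2 * π * K * l) ^ 2) := by
          refine setLIntegral_mono' measurableSet_Ioc fun x hx => ?_
          rw [ENNReal.ofReal_pow (by positivity), ← ofReal_norm]
          gcongr
          exact hmean x hx
      _ = _ := by
          rw [setLIntegral_const, hvol, ← ENNReal.ofReal_mul (by positivity)]
  have hll : l ≤ l ^ lam := by
    conv_lhs => rw [← Real.rpow_one l]
    exact Real.rpow_le_rpow_of_exponent_ge hl0 hl.2 hlam.le
  unfold arcOsc
  calc _ ≤ ((ENNReal.ofReal (2 * π * l ^ lam))⁻¹ *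
        ENNReal.ofReal ((2 * π * K * l) ^ 2 * (2 * π * l))) ^ (1 / 2 : ℝ) := by gcongr
    _ ≤ (ENNReal.ofReal ((2 * π * K * l) ^ 2)) ^ (1 / 2 : ℝ) := by
        gcongr
        rw [← ENNReal.ofReal_inv_of_pos (by positivity), ← ENNReal.ofReal_mul (by positivity)]
        refine ENNReal.ofReal_le_ofReal ?_
        rw [inv_mul_le_iff₀ (by positivity), mul_comm]
        gcongr
    _ = ENNReal.ofReal (2 * π * K * l) := by
        rw [ENNReal.ofReal_rpow_of_nonneg (by positivity) (by norm_num), ← Real.sqrt_eq_rpow,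
          Real.sqrt_sq (by positivity)]

theorem deriv_indicator_ball {F : ℂ → ℂ} {z : ℂ} (hz : z ∈ Metric.ball (0 : ℂ) 1) :
    deriv ((Metric.ball (0 : ℂ) 1).indicator F) z = deriv F z := by
  refine Filter.EventuallyEq.deriv_eq ?_
  filter_upwards [Metric.isOpen_ball.mem_nhds hz] with w hw
  rw [indicator_of_mem hw]

theorem indicator_ball_mem_holDisc {F : ℂ → ℂ} (hF : DifferentiableOn ℂ F (Metric.ball 0 1)) :
    (Metric.ball (0 : ℂ) 1).indicator F ∈ HolDisc :=
  ⟨hF.congr fun _ hz => indicator_of_mem hz F, fun _ hz => indicator_of_notMem hz F⟩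

/-- A function analytic in a neighbourhood of the closed disc belongs to `𝓛^{2,λ}_0`. -/
theorem indicator_ball_mem_littleMorrey {lam : ℝ} (hlam : lam < 1) {F : ℂ → ℂ} {R : ℝ}
    (hR : 1 < R) (hF : DifferentiableOn ℂ F (Metric.ball 0 R)) :
    (Metric.ball (0 : ℂ) 1).indicator F ∈ LittleMorrey lam := by
  have hsub : Metric.closedBall (0 : ℂ) 1 ⊆ Metric.ball 0 R := Metric.closedBall_subset_ball hR
  have hmem : ∀ {r θ : ℝ}, r ∈ Ioo (0 : ℝ) 1 → polarPt r θ ∈ Metric.ball (0 : ℂ) 1 := by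
    intro r θ hr
    simpa [norm_polarPt, abs_of_pos hr.1] using hr.2
  have hcl : ∀ θ : ℝ, polarPt 1 θ ∈ Metric.closedBall (0 : ℂ) 1 := by
    intro θ; simp [norm_polarPt]
  obtain ⟨B, hB⟩ := (isCompact_closedBall (0 : ℂ) 1).exists_bound_of_continuousOn
    (hF.continuousOn.mono hsub)
  obtain ⟨K, hK⟩ := (isCompact_closedBall (0 : ℂ) 1).exists_bound_of_continuousOn
    ((hF.deriv Metric.isOpen_ball).continuousOn.mono hsub)
  have hK0 : 0 ≤ K := (norm_nonneg _).trans (hK 0 (by simp))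
  -- The derivative is bounded on the closed disc, which is convex, and chords are shorter than
  -- arcs.
  have hlip : ∀ x y : ℝ, ‖F (polarPt 1 x) - F (polarPt 1 y)‖ ≤ K * |x - y| := by
    intro x y
    have h := (convex_closedBall (0 : ℂ) 1).norm_image_sub_le_of_norm_deriv_le
      (fun z hz => hF.differentiableAt (Metric.isOpen_ball.mem_nhds (hsub hz))) hK (hcl y) (hcl x)
    refine h.trans ?_
    gcongr
    simpa using dist_polarPt_le 1 x y
  have hcont : Continuous fun θ : ℝ => F (polarPt 1 θ) :=
    hF.continuousOn.comp_continuous (continuous_polarPt_right 1) fun θ => hsub (hcl θ)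
  have hbd : IsBoundaryFn ((Metric.ball (0 : ℂ) 1).indicator F) fun θ => F (polarPt 1 θ) := by
    refine ⟨hcont.locallyIntegrable, Eventually.of_forall fun θ => ?_⟩
    have h1 : Tendsto (fun r : ℝ => F (polarPt r θ)) (𝓝[<] 1) (𝓝 (F (polarPt 1 θ))) := by
      have h2 : Tendsto (fun r : ℝ => polarPt r θ) (𝓝[<] 1) (𝓝 (polarPt 1 θ)) := by
        refine (Continuous.tendsto (f := fun r : ℝ => polarPt r θ) ?_ 1).mono_left
          nhdsWithin_le_nhds
        unfold polarPt; fun_prop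
      exact (hF.differentiableAt (Metric.isOpen_ball.mem_nhds
        (hsub (hcl θ)))).continuousAt.tendsto.comp h2
    refine h1.congr' ?_
    filter_upwards [Ioo_mem_nhdsLT (show (0 : ℝ) < 1 by norm_num)] with r hr
    rw [indicator_of_mem (hmem hr)]
  refine ⟨⟨indicator_ball_mem_holDisc (hF.mono (Metric.ball_subset_ball hR.le)), ?_, _, hbd, ?_⟩,
    _, hbd, ?_⟩
  · refine lt_of_le_of_lt (iSup₂_le fun r hr => ?_) (b := (ENNReal.ofReal (2 * π))⁻¹ *
      (ENNReal.ofReal B ^ 2 * ENNReal.ofReal (2 * π))) ?_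
    · gcongr
      calc _ ≤ ∫⁻ θ in Ioc (0 : ℝ) (2 * π), ENNReal.ofReal B ^ 2 := by
            refine lintegral_mono fun θ => ?_
            rw [indicator_of_mem (hmem hr), ← ofReal_norm]
            gcongr
            exact hB _ (Metric.ball_subset_closedBall (hmem hr))
        _ = _ := by rw [setLIntegral_const, Real.volume_Ioc, sub_zero]
    · have : ENNReal.ofReal (2 * π) ≠ 0 := by simp [Real.pi_pos]
      finiteness
  · refine lt_of_le_of_lt (b := ENNReal.ofReal (2 * π * K * 1)) ?_ ENNReal.ofReal_lt_top
    refine iSup_le fun c => iSup₂_le fun l hl => (arcOsc_le_of_lipschitz hlam hK0 hlip c hl).trans ?_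
    gcongr
    exact hl.2
  · have h0 : Tendsto (fun I : ℝ × ℝ => ENNReal.ofReal (2 * π * K * I.2))
        (comap Prod.snd (𝓝[>] 0)) (𝓝 0) := by
      have h1 : Tendsto (fun l : ℝ => ENNReal.ofReal (2 * π * K * l)) (𝓝[>] 0) (𝓝 0) := by
        have h2 : Tendsto (fun l : ℝ => 2 * π * K * l) (𝓝[>] 0) (𝓝 0) := by
          refine (Continuous.tendsto' (f := fun l : ℝ => 2 * π * K * l) (by fun_prop) 0 0
            (by simp)).mono_left nhdsWithin_le_nhds
        simpa using ENNReal.tendsto_ofReal h2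
      exact h1.comp tendsto_comap
    refine tendsto_of_tendsto_of_tendsto_of_le_of_le' tendsto_const_nhds h0
      (Eventually.of_forall fun _ => zero_le) ?_
    have hev : ∀ᶠ l : ℝ in 𝓝[>] 0, l ∈ Ioc (0 : ℝ) 1 := Ioc_mem_nhdsGT zero_lt_one
    filter_upwards [hev.comap Prod.snd] with I hI
    exact arcOsc_le_of_lipschitz hlam hK0 hlip I.1 hI

/-! ### Carleson boxes and the test functions -/

theorem discMeasure_le_volume : discMeasure ≤ volume := by
  refine Measure.le_iff.2 fun s _ => ?_
  rw [discMeasure, Measure.smul_apply, smul_eq_mul]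
  calc _ ≤ 1 * volume s := by
        gcongr
        · rw [ENNReal.ofReal_le_one]
          exact inv_le_one_of_one_le₀ (by linarith [Real.two_le_pi])
        · exact Measure.restrict_le_self
    _ = _ := one_mul _

theorem ae_discMeasure_mem_ball : ∀ᵐ z ∂discMeasure, z ∈ Metric.ball (0 : ℂ) 1 :=
  Measure.ae_smul_measure (ae_restrict_mem Metric.isOpen_ball.measurableSet) _

/-- Radial displacement is at most l and angular displacement at most πl, and 1 + π < 5. -/
theorem carlesonBox_subset_ball (c : ℝ) {l : ℝ} (hl : 0 < l) :
    carlesonBox c l ⊆ Metric.ball (polarPt 1 c) (5 * l) := by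
  rintro z ⟨h1, h2, θ, hθ, hz⟩
  rw [Metric.mem_ball, dist_eq_norm]
  have e1 : ‖z - polarPt 1 θ‖ = 1 - ‖z‖ := by
    have : z - polarPt 1 θ = ((‖z‖ - 1 : ℝ) : ℂ) * Complex.exp (θ * Complex.I) := by
      conv_lhs => rw [hz]
      rw [polarPt, polarPt]; push_cast; ring
    rw [this, norm_mul, Complex.norm_exp_ofReal_mul_I, Complex.norm_real, mul_one,
      Real.norm_eq_abs, abs_sub_comm, abs_of_pos (by linarith)]
  have e2 : ‖polarPt 1 θ - polarPt 1 c‖ ≤ π * l := by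
    refine (dist_polarPt_le 1 θ c).trans ?_
    rw [abs_one, one_mul, abs_le]
    constructor <;> linarith [hθ.1, hθ.2]
  have e3 := norm_add_le (z - polarPt 1 θ) (polarPt 1 θ - polarPt 1 c)
  rw [sub_add_sub_cancel] at e3
  nlinarith [Real.pi_lt_four]

/-- Split at |1-āz| = l. Below l, put 1-āz = lw: the area factor l²/|a|² ≤ 4l² and homogeneity give
l^λ times the integral of |w|^{λ-2} over the unit disc, finite because λ > 0. Above l, the integrand
is at most l^{λ-2} on a set of area at most 25πl². -/
theorem lintegral_carlesonBox_rpow_le {lam : ℝ} (hlam0 : 0 < lam) (hlam1 : lam < 1) :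
    ∃ C : ℝ≥0, ∀ a : ℂ, 1 / 2 ≤ ‖a‖ → ∀ c : ℝ, ∀ l ∈ Ioc (0 : ℝ) 1,
      ∫⁻ z in carlesonBox c l, ENNReal.ofReal (‖1 - (starRingEnd ℂ) a * z‖ ^ (lam - 2)) ≤
        C * ENNReal.ofReal (l ^ lam) := by
  have hJ := lintegral_ball_norm_rpow_lt_top (α := lam - 2) (by linarith)
  set J := ∫⁻ z in Metric.ball (0 : ℂ) 1, ENNReal.ofReal (‖z‖ ^ (lam - 2)) with hJdef
  refine ⟨(4 * J + 25 * NNReal.pi).toNNReal, fun a ha c l hl => ?_⟩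
  rw [ENNReal.coe_toNNReal (by finiteness)]
  have hl0 := hl.1
  have ha0 : a ≠ 0 := by rw [← norm_pos_iff]; linarith
  have hb0 : (starRingEnd ℂ) a ≠ 0 := by simpa using ha0
  set Φ : ℂ → ℝ≥0∞ := fun z => ENNReal.ofReal (‖1 - (starRingEnd ℂ) a * z‖ ^ (lam - 2)) with hΦ
  set S : Set ℂ := {z | ‖1 - (starRingEnd ℂ) a * z‖ < l} with hS
  set H : ℂ → ℂ := fun w => (1 - l * w) / (starRingEnd ℂ) a with hH
  have hSH : S ⊆ H '' Metric.ball 0 1 := by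
    intro z hz
    refine ⟨(1 - (starRingEnd ℂ) a * z) / l, ?_, ?_⟩
    · rw [mem_ball_zero_iff, norm_div, Complex.norm_real, Real.norm_of_nonneg hl0.le,
        div_lt_one hl0]
      exact hz
    · have : (l : ℂ) ≠ 0 := by exact_mod_cast hl0.ne'
      simp only [hH]
      field_simp
      ring
  have h1 : ∫⁻ z in S, Φ z ≤ 4 * J * ENNReal.ofReal (l ^ lam) := by
    have hder : ∀ w ∈ Metric.ball (0 : ℂ) 1, HasDerivAt H (-l / (starRingEnd ℂ) a) w := by
      intro w _
      have := (((hasDerivAt_id w).const_mul (l : ℂ)).const_sub 1).div_const ((starRingEnd ℂ) a)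
      simpa using this
    have hinj : InjOn H (Metric.ball 0 1) := by
      intro x _ y _ hxy
      have : (l : ℂ) ≠ 0 := by exact_mod_cast hl0.ne'
      simpa [hH, div_left_inj' hb0, this] using hxy
    calc ∫⁻ z in S, Φ z ≤ ∫⁻ z in H '' Metric.ball 0 1, Φ z := lintegral_mono_set hSH
      _ = ∫⁻ w in Metric.ball 0 1, ENNReal.ofReal (‖-(l : ℂ) / (starRingEnd ℂ) a‖ ^ 2) *
            Φ (H w) := lintegral_image_eq_lintegral_normSq_deriv_mul
              Metric.isOpen_ball.measurableSet hder hinj Φ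
      _ ≤ ∫⁻ w in Metric.ball (0 : ℂ) 1, ENNReal.ofReal (4 * l ^ lam) *
            ENNReal.ofReal (‖w‖ ^ (lam - 2)) := by
          refine lintegral_mono fun w => ?_
          simp only [hΦ, hH]
          rw [mul_div_cancel₀ _ hb0, sub_sub_cancel, ← ENNReal.ofReal_mul (by positivity),
            ← ENNReal.ofReal_mul (by positivity)]
          refine ENNReal.ofReal_le_ofReal ?_
          rw [norm_div, norm_neg, RCLike.norm_conj, norm_mul, Complex.norm_real,
            Real.norm_of_nonneg hl0.le, Real.mul_rpow hl0.le (norm_nonneg _), ← mul_assoc]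
          refine mul_le_mul_of_nonneg_right ?_ (by positivity)
          have e1 : (l / ‖a‖) ^ 2 ≤ 4 * l ^ (2 : ℝ) := by
            rw [Real.rpow_two, div_pow, div_le_iff₀ (by positivity)]
            nlinarith [sq_nonneg l, mul_le_mul ha ha (by norm_num) (norm_nonneg a)]
          calc _ ≤ 4 * l ^ (2 : ℝ) * l ^ (lam - 2) := by gcongr
            _ = 4 * l ^ lam := by rw [mul_assoc, ← Real.rpow_add hl0]; ring_nf
      _ = 4 * J * ENNReal.ofReal (l ^ lam) := by
          rw [lintegral_const_mul' _ _ ENNReal.ofReal_ne_top, ENNReal.ofReal_mul (by norm_num)]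
          norm_num
          ring
  have h2 : ∫⁻ z in Metric.ball (polarPt 1 c) (5 * l) \ S, Φ z ≤
      25 * NNReal.pi * ENNReal.ofReal (l ^ lam) := by
    have hSm : MeasurableSet S := (isOpen_lt (by fun_prop) continuous_const).measurableSet
    calc _ ≤ ∫⁻ z in Metric.ball (polarPt 1 c) (5 * l) \ S, ENNReal.ofReal (l ^ (lam - 2)) := by
          refine setLIntegral_mono' (Metric.isOpen_ball.measurableSet.diff hSm) fun z hz => ?_
          exact ENNReal.ofReal_le_ofReal (Real.rpow_le_rpow_of_nonpos hl0 (not_lt.1 hz.2)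
            (by linarith))
      _ ≤ ENNReal.ofReal (l ^ (lam - 2)) * volume (Metric.ball (polarPt 1 c) (5 * l)) := by
          rw [setLIntegral_const]
          gcongr
          exact sdiff_subset
      _ = _ := by
          rw [Complex.volume_ball, mul_comm, ← ENNReal.ofReal_pow (by positivity), mul_comm,
            ← mul_assoc, ← ENNReal.ofReal_mul (by positivity), mul_pow, mul_left_comm,
            ← Real.rpow_two l, ← Real.rpow_add hl0, ENNReal.ofReal_mul (by positivity)]
          norm_num
          ring
  calc _ ≤ ∫⁻ z in S ∪ Metric.ball (polarPt 1 c) (5 * l) \ S, Φ z := by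
        refine lintegral_mono_set fun z hz => ?_
        by_cases hzS : z ∈ S
        · exact Or.inl hzS
        · exact Or.inr ⟨carlesonBox_subset_ball c hl0 hz, hzS⟩
    _ ≤ _ := (lintegral_union_le _ _ _).trans (by rw [add_mul]; exact add_le_add h1 h2)

/-- The witness is (1-āz)^{-b} with b = (1-λ)/2. Since 1-|z|² ≤ 2|1-āz|, the density |f'|²(1-|z|²)
is at most 2|1-āz|^{-2b-1} = 2|1-āz|^{λ-2}, to which the preceding box estimate applies. -/
theorem exists_littleMorrey_test_function {lam : ℝ} (hlam0 : 0 < lam) (hlam1 : lam < 1) :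
    ∃ C : ℝ≥0, 0 < C ∧ ∀ a : ℂ, 1 / 2 ≤ ‖a‖ → ‖a‖ < 1 → ∃ f ∈ LittleMorrey lam,
      morreyNorm lam f ≤ C ∧ ‖f a‖ = (1 - ‖a‖ ^ 2) ^ (-((1 - lam) / 2)) := by
  obtain ⟨C, hC⟩ := lintegral_carlesonBox_rpow_le hlam0 hlam1
  refine ⟨1 + (2 * C) ^ (1 / 2 : ℝ), by positivity, fun a ha ha1 => ?_⟩
  set b := (1 - lam) / 2 with hb
  set F : ℂ → ℂ := fun z => (1 - (starRingEnd ℂ) a * z) ^ (-(b : ℂ)) with hF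
  have hslit : ∀ z : ℂ, ‖a‖ * ‖z‖ < 1 → 1 - (starRingEnd ℂ) a * z ∈ Complex.slitPlane := by
    intro z hz
    refine Complex.mem_slitPlane_of_norm_lt_one (z := -((starRingEnd ℂ) a * z)) ?_
    simpa using hz
  have hder : ∀ z : ℂ, ‖a‖ * ‖z‖ < 1 → HasDerivAt F
      (-(b : ℂ) * (1 - (starRingEnd ℂ) a * z) ^ (-(b : ℂ) - 1) * -(starRingEnd ℂ) a) z := by
    intro z hz
    have h1 : HasDerivAt (fun z => 1 - (starRingEnd ℂ) a * z) (-(starRingEnd ℂ) a) z := by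
      simpa using ((hasDerivAt_id z).const_mul ((starRingEnd ℂ) a)).const_sub 1
    exact h1.cpow_const (hslit z hz)
  -- On |z| < 1/|a| the base 1-āz avoids the branch cut, so the power is analytic beyond the closed
  -- unit disc and lies in 𝓛^{2,λ}_0.
  have hb1 : 1 < 1 / ‖a‖ := by rw [lt_div_iff₀ (by linarith)]; linarith
  have hlt : ∀ {z : ℂ}, z ∈ Metric.ball (0 : ℂ) 1 → ‖a‖ * ‖z‖ < 1 := by
    intro z hz
    have : ‖z‖ < 1 := by simpa using hz
    nlinarith [norm_nonneg z]
  refine ⟨(Metric.ball (0 : ℂ) 1).indicator F, indicator_ball_mem_littleMorrey hlam1 hb1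
    fun z hz => (hder z ?_).differentiableAt.differentiableWithinAt, ?_, ?_⟩
  · have : ‖z‖ < 1 / ‖a‖ := by simpa using hz
    rwa [lt_div_iff₀ (by linarith), mul_comm] at this
  · unfold morreyNorm
    push_cast
    refine add_le_add ?_ (iSup_le fun c => iSup₂_le fun l hl => ?_)
    · rw [indicator_of_mem (by simp)]
      simp [hF]
    · rw [ENNReal.coe_rpow_of_nonneg _ (by norm_num)]
      gcongr
      rw [mul_comm, ← div_eq_mul_inv]
      refine ENNReal.div_le_of_le_mul ?_
      push_cast
      calc _ ≤ ∫⁻ z in carlesonBox c l,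
            2 * ENNReal.ofReal (‖1 - (starRingEnd ℂ) a * z‖ ^ (lam - 2)) ∂discMeasure := by
            refine lintegral_mono_ae (ae_restrict_of_ae ?_)
            filter_upwards [ae_discMeasure_mem_ball] with z hz
            rw [deriv_indicator_ball hz, (hder z (hlt hz)).deriv]
            have hz1 : ‖z‖ < 1 := by simpa using hz
            have hw0 := norm_pos_iff.2 (one_sub_conj_mul_ne_zero ha1 hz1.le)
            have hw1 := one_sub_le_norm_one_sub_conj_mul (z := z) ha1.le
            rw [norm_mul, norm_mul, norm_neg, norm_neg, RCLike.norm_conj, Complex.norm_real,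
              show -(b : ℂ) - 1 = ((-b - 1 : ℝ) : ℂ) by push_cast; ring,
              Complex.norm_cpow_real,
              show (2 : ℝ≥0∞) = ENNReal.ofReal 2 by norm_num, ← ENNReal.ofReal_mul (by norm_num)]
            refine ENNReal.ofReal_le_ofReal ?_
            set w := ‖1 - (starRingEnd ℂ) a * z‖ with hw
            have hbn : ‖b‖ ≤ 1 := by
              rw [Real.norm_of_nonneg (by linarith)]; linarith
            have e1 : 1 - ‖z‖ ^ 2 ≤ 2 * w := by nlinarith [norm_nonneg z]
            have e2 : 0 ≤ 1 - ‖z‖ ^ 2 := by nlinarith [norm_nonneg z]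
            calc (‖b‖ * w ^ (-b - 1) * ‖a‖) ^ 2 * (1 - ‖z‖ ^ 2)
                ≤ (1 * w ^ (-b - 1) * 1) ^ 2 * (2 * w) := by gcongr
              _ = 2 * w ^ (lam - 2) := by
                rw [one_mul, mul_one, ← Real.rpow_two, ← Real.rpow_mul hw0.le, mul_left_comm]
                congr 1
                conv_lhs => rw [mul_comm]; enter [1]; rw [← Real.rpow_one w]
                rw [← Real.rpow_add hw0]
                congr 1
                rw [hb]; ring
        _ ≤ ∫⁻ z in carlesonBox c l,
            2 * ENNReal.ofReal (‖1 - (starRingEnd ℂ) a * z‖ ^ (lam - 2)) :=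
            lintegral_mono' (Measure.restrict_mono_measure discMeasure_le_volume _) le_rfl
        _ ≤ 2 * C * ENNReal.ofReal (l ^ lam) := by
            rw [lintegral_const_mul' _ _ (by norm_num), mul_assoc]
            gcongr
            exact hC a ha c l hl
  · have ha2 : 0 < 1 - ‖a‖ ^ 2 := by nlinarith
    rw [indicator_of_mem (by simpa using ha1)]
    simp only [hF]
    rw [show (1 - (starRingEnd ℂ) a * a) = ((1 - ‖a‖ ^ 2 : ℝ) : ℂ) by
        rw [← Complex.normSq_eq_conj_mul_self, Complex.normSq_eq_norm_sq]; push_cast; ring,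
      show -(b : ℂ) = ((-b : ℝ) : ℂ) by push_cast; ring, Complex.norm_cpow_real, Complex.norm_real,
      Real.norm_of_nonneg ha2.le]

/-! ### The pointwise weight against the integral -/

/-- `(1 - |z|²)^{(1+λ)/2} |g'(z)|`. -/
noncomputable def blochMorreyWeight (lam : ℝ) (g : ℂ → ℂ) (z : ℂ) : ℝ≥0∞ :=
  ENNReal.ofReal ((1 - ‖z‖ ^ 2) ^ ((1 + lam) / 2) * ‖deriv g z‖)

instance toBoundary_neBot : toBoundary.NeBot := by
  refine comap_neBot fun t ht => ?_
  obtain ⟨x, hx, hxt⟩ := Filter.nonempty_of_mem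
    (inter_mem (Ioo_mem_nhdsLT (show (0 : ℝ) < 1 by norm_num)) ht)
  exact ⟨(x : ℂ), by rwa [Complex.norm_real, Real.norm_of_nonneg hx.1.le]⟩

instance toBoundary_isCountablyGenerated : toBoundary.IsCountablyGenerated := by
  unfold toBoundary; infer_instance

theorem tendsto_norm_toBoundary : Tendsto (fun a : ℂ => ‖a‖) toBoundary (𝓝 1) :=
  tendsto_comap.mono_right nhdsWithin_le_nhds

theorem exists_forall_of_eventually_toBoundary {P : ℂ → Prop} (h : ∀ᶠ z in toBoundary, P z) :
    ∃ R : ℝ, 0 < R ∧ R < 1 ∧ ∀ z : ℂ, R < ‖z‖ → ‖z‖ < 1 → P z := by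
  rw [toBoundary, eventually_comap] at h
  obtain ⟨R, hR, hR'⟩ := (mem_nhdsLT_iff_exists_mem_Ico_Ioo_subset
    (show (0 : ℝ) < 1 by norm_num)).1 h
  refine ⟨max R (1 / 2), by positivity, max_lt hR.2 (by norm_num), fun z h1 h2 => ?_⟩
  exact hR' ⟨(le_max_left _ _).trans_lt h1, h2⟩ z rfl

theorem blochMorreyWeight_le_blochMorreyIntegral {lam p : ℝ} (hlam0 : 0 < lam) (hlam1 : lam < 1)
    (hp : 1 < p) : ∃ C : ℝ≥0, 0 < C ∧ ∀ g : ℂ → ℂ, DifferentiableOn ℂ g (Metric.ball 0 1) →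
      ∀ a ∈ Metric.ball (0 : ℂ) 1, blochMorreyWeight lam g a ≤ C * blochMorreyIntegral p lam g a := by
  set s := p + 1 - lam with hs
  have hs0 : 0 < s := by linarith
  -- The bracket cancels the numerical constants of m(d/2)², with m below; the leading 4 absorbs
  -- (1-|a|²)^{1+λ} ≤ (2d)^{1+λ} ≤ 4d^{1+λ}.
  set k : ℝ := 4 * ((9 : ℝ) ^ s * 2 ^ p * 4) with hk
  refine ⟨k.toNNReal ^ (1 / 2 : ℝ), by positivity, fun g hg a ha => ?_⟩
  have ha1 : ‖a‖ < 1 := by simpa using ha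
  set d := 1 - ‖a‖ with hd
  have hd0 : 0 < d := by linarith
  have hd1 : d ≤ 1 := by linarith [norm_nonneg a]
  have hball : ∀ z ∈ Metric.ball a (d / 2), ‖z‖ < 1 - d / 2 ∧ ‖a - z‖ < d / 2 := by
    intro z hz
    have h1 : ‖z - a‖ < d / 2 := by simpa [dist_eq_norm] using hz
    have h2 := norm_add_le (z - a) a
    rw [sub_add_cancel] at h2
    exact ⟨by linarith, by rwa [norm_sub_rev]⟩
  have hsub : Metric.ball a (d / 2) ⊆ Metric.ball 0 1 := fun z hz => by
    have := (hball z hz).1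
    rw [mem_ball_zero_iff]; linarith
  have hmean := normSq_center_le_lintegral_ball (a := a) (r := d / 2) (by positivity)
    ((hg.deriv Metric.isOpen_ball).mono hsub)
  -- On the disc of radius d/2 about `a`, |1-āz| ≤ 3d and 1-|z|² ≥ d/2, so m bounds from below the
  -- factor multiplying |g'|².
  set m : ℝ := (1 / (9 * d)) ^ s * (d / 2) ^ p with hm
  have hm0 : 0 < m := by positivity
  have hlow : ENNReal.ofReal m * (ENNReal.ofReal ((d / 2) ^ 2) * ‖deriv g a‖ₑ ^ 2) ≤
      ∫⁻ z, ENNReal.ofReal (((1 - ‖a‖ ^ 2) / ‖1 - (starRingEnd ℂ) a * z‖ ^ 2) ^ s *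
        ‖deriv g z‖ ^ 2 * (1 - ‖z‖ ^ 2) ^ p) ∂discMeasure := by
    rw [discMeasure, lintegral_smul_measure, smul_eq_mul]
    calc _ = ENNReal.ofReal π⁻¹ * (ENNReal.ofReal m *
          (ENNReal.ofReal (π * (d / 2) ^ 2) * ‖deriv g a‖ₑ ^ 2)) := by
          rw [← mul_assoc (ENNReal.ofReal m) (ENNReal.ofReal (π * (d / 2) ^ 2)),
            ← ENNReal.ofReal_mul hm0.le, ← mul_assoc, ← mul_assoc,
            ← ENNReal.ofReal_mul hm0.le, ← ENNReal.ofReal_mul (by positivity)]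
          congr 2
          field_simp
      _ ≤ ENNReal.ofReal π⁻¹ * (ENNReal.ofReal m *
          ∫⁻ z in Metric.ball a (d / 2), ‖deriv g z‖ₑ ^ 2) := by gcongr
      _ ≤ _ := by
        gcongr
        rw [← lintegral_const_mul' _ _ ENNReal.ofReal_ne_top]
        refine (setLIntegral_mono' Metric.isOpen_ball.measurableSet fun z hz => ?_).trans
          (lintegral_mono_set hsub)
        obtain ⟨h1, h2⟩ := hball z hz
        have hz1 : ‖z‖ < 1 := by linarith
        have h0 := norm_pos_iff.2 (one_sub_conj_mul_ne_zero ha1 hz1.le)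
        rw [← ofReal_norm, ← ENNReal.ofReal_pow (norm_nonneg _), ← ENNReal.ofReal_mul hm0.le]
        refine ENNReal.ofReal_le_ofReal ?_
        have h3 : ‖1 - (starRingEnd ℂ) a * z‖ ≤ 3 * d := by
          have e1 : 1 - (starRingEnd ℂ) a * z =
              ((1 - ‖a‖ ^ 2 : ℝ) : ℂ) + (starRingEnd ℂ) a * (a - z) := by
            rw [mul_sub, ← Complex.normSq_eq_conj_mul_self, Complex.normSq_eq_norm_sq]
            push_cast; ring
          rw [e1]
          refine (norm_add_le _ _).trans ?_
          rw [norm_mul, RCLike.norm_conj, Complex.norm_real,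
            Real.norm_of_nonneg (by nlinarith [norm_nonneg a])]
          nlinarith [norm_nonneg a, norm_nonneg (a - z)]
        have h4 : 1 / (9 * d) ≤ (1 - ‖a‖ ^ 2) / ‖1 - (starRingEnd ℂ) a * z‖ ^ 2 := by
          rw [div_le_div_iff₀ (by positivity) (by positivity)]
          have e2 : d ≤ 1 - ‖a‖ ^ 2 := by nlinarith [norm_nonneg a]
          nlinarith [mul_le_mul h3 h3 h0.le (by positivity)]
        have h5 : d / 2 ≤ 1 - ‖z‖ ^ 2 := by nlinarith [norm_nonneg z]
        have h6 : 0 ≤ 1 - ‖z‖ ^ 2 := by linarith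
        have h7 : 0 ≤ 1 - ‖a‖ ^ 2 := by nlinarith [norm_nonneg a]
        rw [hm, mul_assoc, mul_assoc, mul_comm (‖deriv g z‖ ^ 2)]
        gcongr
  have hW : blochMorreyWeight lam g a =
      (ENNReal.ofReal (((1 - ‖a‖ ^ 2) ^ ((1 + lam) / 2) * ‖deriv g a‖) ^ 2)) ^ (1 / 2 : ℝ) := by
    have : 0 ≤ 1 - ‖a‖ ^ 2 := by nlinarith [norm_nonneg a]
    rw [ENNReal.ofReal_rpow_of_nonneg (by positivity) (by norm_num), ← Real.sqrt_eq_rpow,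
      Real.sqrt_sq (by positivity), blochMorreyWeight]
  rw [hW, blochMorreyIntegral, ENNReal.coe_rpow_of_nonneg _ (by norm_num),
    ← ENNReal.mul_rpow_of_nonneg _ _ (by norm_num)]
  gcongr
  refine le_trans ?_ (mul_le_mul_right hlow _)
  have h8 : ((k.toNNReal : ℝ≥0) : ℝ≥0∞) = ENNReal.ofReal k := rfl
  rw [h8, ← ofReal_norm, ← ENNReal.ofReal_pow (norm_nonneg _),
    ← ENNReal.ofReal_mul (by positivity), ← ENNReal.ofReal_mul (by positivity),
    ← ENNReal.ofReal_mul (by positivity)]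
  refine ENNReal.ofReal_le_ofReal ?_
  have h9 : 0 ≤ 1 - ‖a‖ ^ 2 := by nlinarith [norm_nonneg a]
  have h10 : 1 - ‖a‖ ^ 2 ≤ 2 * d := by nlinarith [norm_nonneg a]
  have h11 : k * (m * (d / 2) ^ 2) = 4 * d ^ (1 + lam) := by
    have e3 : d ^ (1 + lam) = d ^ p * d ^ (2 : ℝ) / d ^ s := by
      rw [← Real.rpow_add hd0, ← Real.rpow_sub hd0, hs]
      ring_nf
    rw [e3, hk, hm, Real.div_rpow one_pos.le (by positivity), Real.one_rpow,
      Real.mul_rpow (by norm_num) hd0.le, Real.div_rpow hd0.le (by norm_num), Real.rpow_two]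
    have e4 : d ^ s ≠ 0 := by positivity
    field_simp
    norm_num
  have h12 : ((1 - ‖a‖ ^ 2) ^ ((1 + lam) / 2)) ^ 2 ≤ 4 * d ^ (1 + lam) := by
    rw [← Real.rpow_two, ← Real.rpow_mul h9, div_mul_cancel₀ _ (by norm_num)]
    calc _ ≤ (2 * d) ^ (1 + lam) := by gcongr
      _ = 2 ^ (1 + lam) * d ^ (1 + lam) := Real.mul_rpow (by norm_num) hd0.le
      _ ≤ 2 ^ (2 : ℝ) * d ^ (1 + lam) := by gcongr <;> linarith
      _ = _ := by norm_num
  rw [mul_pow]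
  calc _ ≤ 4 * d ^ (1 + lam) * ‖deriv g a‖ ^ 2 := by gcongr
    _ = _ := by rw [← h11]; ring

theorem limsup_blochMorreyIntegral_le {lam p : ℝ} (hlam0 : 0 < lam) (hlam1 : lam < 1)
    (hp : 1 < p) : ∃ C : ℝ≥0, 0 < C ∧ ∀ g : ℂ → ℂ, DifferentiableOn ℂ g (Metric.ball 0 1) →
      limsup (blochMorreyIntegral p lam g) toBoundary ≤
        C * limsup (blochMorreyWeight lam g) toBoundary := by
  set s := p + 1 - lam with hs
  have hs0 : 0 < s := by linarith
  set q := p - 1 - lam with hq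
  have hJ := lintegral_ball_one_sub_normSq_rpow_lt_top (q := q) (by linarith)
  set J := ∫⁻ w in Metric.ball (0 : ℂ) 1, ENNReal.ofReal ((1 - ‖w‖ ^ 2) ^ q) with hJdef
  -- Adding 1 makes positivity immediate.
  refine ⟨J.toNNReal ^ (1 / 2 : ℝ) + 1, by positivity, fun g hg => ?_⟩
  set C : ℝ≥0 := J.toNNReal ^ (1 / 2 : ℝ) + 1 with hC
  have hJC : J ^ (1 / 2 : ℝ) ≤ C := by
    rw [hC, ENNReal.coe_add, ENNReal.coe_rpow_of_nonneg _ (by norm_num),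
      ENNReal.coe_toNNReal hJ.ne]
    exact le_self_add
  have hC0 : (C : ℝ≥0∞) ≠ 0 := by simp [hC]
  refine le_of_forall_gt fun c hc => ?_
  rw [mul_comm, ← ENNReal.lt_div_iff_mul_lt (Or.inl hC0) (Or.inl ENNReal.coe_ne_top)] at hc
  obtain ⟨b, hb1, hb2⟩ := ENNReal.lt_iff_exists_nnreal_btwn.1 hc
  rw [ENNReal.lt_div_iff_mul_lt (Or.inl hC0) (Or.inl ENNReal.coe_ne_top)] at hb2
  refine lt_of_le_of_lt ?_ hb2
  obtain ⟨R, hR0, hR1, hR⟩ := exists_forall_of_eventually_toBoundary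
    (eventually_lt_of_limsup_lt hb1)
  have hRsub : Metric.closedBall (0 : ℂ) R ⊆ Metric.ball 0 1 := Metric.closedBall_subset_ball hR1
  obtain ⟨G, hG⟩ := (isCompact_closedBall (0 : ℂ) R).exists_bound_of_continuousOn
    ((hg.deriv Metric.isOpen_ball).continuousOn.mono hRsub)
  have hG0 : 0 ≤ G := (norm_nonneg _).trans (hG 0 (by simp [hR0.le]))
  have hbound : ∀ a : ℂ, ‖a‖ < 1 → blochMorreyIntegral p lam g a ≤
      (ENNReal.ofReal (((1 - ‖a‖ ^ 2) / (1 - R) ^ 2) ^ s * G ^ 2) * volume (Metric.ball (0 : ℂ) 1) +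
        b ^ 2 * J) ^ (1 / 2 : ℝ) := by
    intro a ha
    have h7 : 0 ≤ 1 - ‖a‖ ^ 2 := by nlinarith [norm_nonneg a]
    rw [blochMorreyIntegral, ← hs]
    gcongr
    calc _ ≤ ∫⁻ z in Metric.ball (0 : ℂ) 1,
          ENNReal.ofReal (((1 - ‖a‖ ^ 2) / ‖1 - (starRingEnd ℂ) a * z‖ ^ 2) ^ s *
            ‖deriv g z‖ ^ 2 * (1 - ‖z‖ ^ 2) ^ p) := by
          rw [discMeasure, lintegral_smul_measure, smul_eq_mul]
          refine mul_le_of_le_one_left' ?_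
          rw [ENNReal.ofReal_le_one]
          exact inv_le_one_of_one_le₀ (by linarith [Real.two_le_pi])
      -- The first summand dominates the integrand for |z| ≤ R, where |1-āz| ≥ 1-R; the second
      -- dominates it for |z| > R, where the weight is below b.
      _ ≤ ∫⁻ z in Metric.ball (0 : ℂ) 1,
          (ENNReal.ofReal (((1 - ‖a‖ ^ 2) / (1 - R) ^ 2) ^ s * G ^ 2) + b ^ 2 *
            ENNReal.ofReal (((1 - ‖a‖ ^ 2) / ‖1 - (starRingEnd ℂ) a * z‖ ^ 2) ^ (q + 2) *
              (1 - ‖z‖ ^ 2) ^ q)) := by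
          refine setLIntegral_mono' Metric.isOpen_ball.measurableSet fun z hz => ?_
          have hz1 : ‖z‖ < 1 := by simpa using hz
          have hz2 : 0 < 1 - ‖z‖ ^ 2 := by nlinarith [norm_nonneg z]
          rcases le_or_gt ‖z‖ R with hzR | hzR
          · refine le_trans (ENNReal.ofReal_le_ofReal ?_) le_self_add
            have e1 : 1 - R ≤ ‖1 - (starRingEnd ℂ) a * z‖ := by
              linarith [one_sub_le_norm_one_sub_conj_mul (z := z) ha.le]
            have e2 : 0 < 1 - R := by linarith
            have e3 : (1 - ‖z‖ ^ 2) ^ p ≤ 1 :=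
              Real.rpow_le_one hz2.le (by nlinarith [norm_nonneg z]) (by linarith)
            calc _ ≤ ((1 - ‖a‖ ^ 2) / (1 - R) ^ 2) ^ s * G ^ 2 * 1 := by
                  gcongr
                  exact hG z (by simpa using hzR)
              _ = _ := mul_one _
          · refine le_trans ?_ le_add_self
            have e1 := (hR z hzR hz1).le
            rw [blochMorreyWeight, ← ENNReal.ofReal_coe_nnreal] at e1
            replace e1 := (ENNReal.ofReal_le_ofReal_iff b.coe_nonneg).1 e1
            rw [← ENNReal.ofReal_coe_nnreal, ← ENNReal.ofReal_pow b.coe_nonneg,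
              ← ENNReal.ofReal_mul (by positivity)]
            refine ENNReal.ofReal_le_ofReal ?_
            have e2 : ‖deriv g z‖ ^ 2 * (1 - ‖z‖ ^ 2) ^ p =
                ((1 - ‖z‖ ^ 2) ^ ((1 + lam) / 2) * ‖deriv g z‖) ^ 2 * (1 - ‖z‖ ^ 2) ^ q := by
              rw [mul_pow, ← Real.rpow_two ((1 - ‖z‖ ^ 2) ^ ((1 + lam) / 2)),
                ← Real.rpow_mul hz2.le, mul_right_comm, ← Real.rpow_add hz2, mul_comm, hq]
              ring_nf
            rw [show q + 2 = s by rw [hq, hs]; ring, mul_assoc, e2, mul_left_comm]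
            gcongr
      _ = _ := by
          rw [lintegral_add_left measurable_const, setLIntegral_const,
            lintegral_const_mul' _ _ (by finiteness), ← lintegral_ball_eq_lintegral_mobius q ha]
  -- With R fixed the inner part vanishes as |a| → 1, because s > 0; the Möbius-invariant part
  -- remains.
  have hlim : Tendsto (fun a : ℂ =>
      (ENNReal.ofReal (((1 - ‖a‖ ^ 2) / (1 - R) ^ 2) ^ s * G ^ 2) * volume (Metric.ball (0 : ℂ) 1) +
        b ^ 2 * J) ^ (1 / 2 : ℝ)) toBoundary (𝓝 ((b ^ 2 * J) ^ (1 / 2 : ℝ))) := by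
    have h1 : Tendsto (fun a : ℂ => ((1 - ‖a‖ ^ 2) / (1 - R) ^ 2) ^ s * G ^ 2) toBoundary (𝓝 0) := by
      have h2 : Continuous fun x : ℝ => ((1 - x ^ 2) / (1 - R) ^ 2) ^ s * G ^ 2 := by
        refine Continuous.mul (Continuous.rpow_const (by fun_prop) fun _ => Or.inr hs0.le)
          continuous_const
      have h3 := (h2.tendsto 1).comp tendsto_norm_toBoundary
      simpa [Function.comp_def, hs0.ne', Real.zero_rpow] using h3
    have h2 := ENNReal.tendsto_ofReal h1
    rw [ENNReal.ofReal_zero] at h2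
    have h3 := ENNReal.Tendsto.mul_const (b := volume (Metric.ball (0 : ℂ) 1)) h2
      (Or.inr measure_ball_lt_top.ne)
    rw [zero_mul] at h3
    have h4 := (h3.add_const (b ^ 2 * J)).ennrpow_const (1 / 2 : ℝ)
    rwa [zero_add] at h4
  calc limsup (blochMorreyIntegral p lam g) toBoundary ≤ (b ^ 2 * J) ^ (1 / 2 : ℝ) := by
        rw [← hlim.limsup_eq]
        refine limsup_le_limsup ?_
        filter_upwards [eventually_toBoundary_mem_ball] with a ha
        exact hbound a (by simpa using ha)
    _ = b * J ^ (1 / 2 : ℝ) := by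
        rw [ENNReal.mul_rpow_of_nonneg _ _ (by norm_num), ← ENNReal.rpow_two, ← ENNReal.rpow_mul]
        norm_num
    _ ≤ b * C := by gcongr

/-! ### The Volterra operator and the lower bound for the essential norm -/

/-- The analytic function f g' has a primitive P on the disc, and integrating along the segment [0,
w] returns P(w) - P(0). -/
theorem hasDerivAt_volterra {g f : ℂ → ℂ} (hg : DifferentiableOn ℂ g (Metric.ball 0 1))
    (hf : f ∈ HolDisc) {z : ℂ} (hz : z ∈ Metric.ball (0 : ℂ) 1) :
    HasDerivAt (volterra g f) (f z * deriv g z) z := by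
  have hfg : DifferentiableOn ℂ (fun w => f w * deriv g w) (Metric.ball 0 1) :=
    hf.1.mul (hg.deriv Metric.isOpen_ball)
  obtain ⟨P, hP⟩ := hfg.isExactOn_ball
  have hvol : ∀ w ∈ Metric.ball (0 : ℂ) 1, volterra g f w = P w - P 0 := by
    intro w hw
    have hseg : ∀ t ∈ uIcc (0 : ℝ) 1, (t : ℂ) * w ∈ Metric.ball (0 : ℂ) 1 := by
      intro t ht
      rw [uIcc_of_le zero_le_one] at ht
      rw [mem_ball_zero_iff] at hw ⊢
      rw [norm_mul, Complex.norm_real, Real.norm_of_nonneg ht.1]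
      nlinarith [ht.1, ht.2, norm_nonneg w]
    have hder : ∀ t ∈ uIcc (0 : ℝ) 1, HasDerivAt (fun t : ℝ => P (t * w))
        (f (t * w) * deriv g (t * w) * w) t := by
      intro t ht
      have h1 : HasDerivAt (fun t : ℝ => (t : ℂ) * w) w t := by
        simpa using (Complex.ofRealCLM.hasDerivAt (x := t)).mul_const w
      exact (hP _ (hseg t ht)).comp t h1
    rw [volterra, if_pos hw, intervalIntegral.integral_eq_sub_of_hasDerivAt hder
      (volterra_integrable hg hf hw)]
    simp
  have h2 : HasDerivAt (fun w => P w - P 0) (f z * deriv g z) z := (hP z hz).sub_const _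
  refine h2.congr_of_eventuallyEq ?_
  filter_upwards [Metric.isOpen_ball.mem_nhds hz] with w hw using hvol w hw

theorem volterra_zero (g f : ℂ → ℂ) : volterra g f 0 = 0 := by
  simp [volterra]

theorem morreyNorm_smul_le (lam : ℝ) (a : ℂ) (f : ℂ → ℂ) :
    morreyNorm lam (a • f) ≤ ‖a‖ₑ * morreyNorm lam f := by
  unfold morreyNorm
  rw [mul_add]
  refine add_le_add (by simp) (iSup_le fun c => iSup₂_le fun l hl => ?_)
  refine le_trans (le_of_eq ?_) (mul_le_mul_right (le_iSup_of_le c (le_iSup₂_of_le l hl le_rfl)) _)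
  have h : ∀ z, ENNReal.ofReal (‖deriv (a • f) z‖ ^ 2 * (1 - ‖z‖ ^ 2)) =
      ‖a‖ₑ ^ 2 * ENNReal.ofReal (‖deriv f z‖ ^ 2 * (1 - ‖z‖ ^ 2)) := by
    intro z
    rw [show (a • f) = fun z => a • f z from rfl, deriv_fun_const_smul_field, norm_smul, mul_pow,
      mul_assoc,
      ENNReal.ofReal_mul (by positivity), ENNReal.ofReal_pow (norm_nonneg _), ofReal_norm]
  simp only [h]
  rw [lintegral_const_mul' _ _ (by finiteness), mul_left_comm,
    ENNReal.mul_rpow_of_nonneg _ _ (by norm_num), ← ENNReal.rpow_two, ← ENNReal.rpow_mul]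
  norm_num

theorem ofReal_deriv_le_blochNorm (f : ℂ → ℂ) {z : ℂ} (hz : z ∈ Metric.ball (0 : ℂ) 1) :
    ENNReal.ofReal ((1 - ‖z‖ ^ 2) * ‖deriv f z‖) ≤ blochNorm f :=
  (le_iSup₂ (f := fun z (_ : z ∈ Metric.ball (0 : ℂ) 1) =>
    ENNReal.ofReal ((1 - ‖z‖ ^ 2) * ‖deriv f z‖)) z hz).trans le_add_self

theorem exists_normalized_test_function {lam : ℝ} (hlam0 : 0 < lam) (hlam1 : lam < 1) :
    ∃ k : ℝ≥0, 0 < k ∧ ∀ a : ℂ, 1 / 2 ≤ ‖a‖ → ‖a‖ < 1 → ∃ f ∈ LittleMorrey lam,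
      morreyNorm lam f ≤ 1 ∧ ‖f a‖ = k * (1 - ‖a‖ ^ 2) ^ (-((1 - lam) / 2)) := by
  obtain ⟨C, hC0, hC⟩ := exists_littleMorrey_test_function hlam0 hlam1
  refine ⟨C⁻¹, by positivity, fun a ha ha1 => ?_⟩
  obtain ⟨f, hf, hf1, hf2⟩ := hC a ha ha1
  have hn : ‖((C⁻¹ : ℝ≥0) : ℂ)‖ₑ = (C : ℝ≥0∞)⁻¹ := by
    rw [← ofReal_norm, ← ENNReal.coe_inv hC0.ne', ← ENNReal.ofReal_coe_nnreal]
    congr 1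
    simp
  refine ⟨((C⁻¹ : ℝ≥0) : ℂ) • f, Submodule.smul_mem _ _ hf, ?_, ?_⟩
  · refine (morreyNorm_smul_le _ _ _).trans ?_
    rw [hn]
    refine (mul_le_mul_right hf1 _).trans (le_of_eq ?_)
    exact ENNReal.inv_mul_cancel (by exact_mod_cast hC0.ne') ENNReal.coe_ne_top
  · rw [Pi.smul_apply, norm_smul, hf2]
    simp

theorem limsup_blochMorreyWeight_le_essNorm {lam : ℝ} (hlam0 : 0 < lam) (hlam1 : lam < 1) :
    ∃ C : ℝ≥0, 0 < C ∧ ∀ (g : ℂ → ℂ) (hg : DifferentiableOn ℂ g (Metric.ball 0 1))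
      (hmap : ∀ f ∈ LittleMorrey lam, volterra g f ∈ LittleBloch),
      limsup (blochMorreyWeight lam g) toBoundary ≤
        C * essNormOf (morreyNorm lam) blochNorm (volterraOp lam hg hmap) := by
  obtain ⟨k, hk0, hk⟩ := exists_normalized_test_function hlam0 hlam1
  refine ⟨k⁻¹, by positivity, fun g hg hmap => ?_⟩
  have hk0' : (k : ℝ≥0∞) ≠ 0 := by exact_mod_cast hk0.ne'
  rw [ENNReal.coe_inv hk0.ne', mul_comm, ← div_eq_mul_inv,
    ENNReal.le_div_iff_mul_le (Or.inl hk0') (Or.inl ENNReal.coe_ne_top)]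
  refine le_iInf₂ fun K hK => ?_
  set N := opNormOf (morreyNorm lam) blochNorm (volterraOp lam hg hmap - K) with hN
  rw [← ENNReal.le_div_iff_mul_le (Or.inl hk0') (Or.inl ENNReal.coe_ne_top)]
  by_contra! hlt
  obtain ⟨b, hb1, hb2⟩ := exists_between hlt
  have hev : ∀ᶠ a in toBoundary, 1 / 2 ≤ ‖a‖ ∧ ‖a‖ < 1 := by
    filter_upwards [eventually_toBoundary_mem_ball,
      tendsto_norm_toBoundary.eventually (Ioi_mem_nhds (show (1 / 2 : ℝ) < 1 by norm_num))]
      with a h1 h2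
    exact ⟨le_of_lt h2, by simpa using h1⟩
  -- Points tending to the circle at which the weight exceeds b, where b was chosen above N/k.
  obtain ⟨a, ha, hab⟩ := exists_seq_forall_of_frequently
    ((frequently_lt_of_lt_limsup (by isBoundedDefault) hb2).and_eventually hev)
  choose f hfmem hfn hfa using fun n => hk (a n) (hab n).2.1 (hab n).2.2
  obtain ⟨h, s, hs, hlim⟩ := hK (fun n => ⟨f n, hfmem n⟩) hfn
  -- Write T f = (T-K)f + (Kf-h) + h and compare derivatives at a_n, where (1-|a_n|²)|(T f)'(a_n)|
  -- is exactly k times the weight. The last two terms tend to 0: one by compactness, the other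
  -- because h is in B_0.
  have hbound : ∀ j, b * k ≤ N + (blochNorm (K ⟨f (s j), hfmem (s j)⟩ - h) +
      ENNReal.ofReal ((1 - ‖a (s j)‖ ^ 2) * ‖deriv (h : ℂ → ℂ) (a (s j))‖)) := by
    intro j
    set n := s j
    set u : LittleMorrey lam := ⟨f n, hfmem n⟩ with hu
    obtain ⟨hWb, -, ha1⟩ := hab n
    have hball : a n ∈ Metric.ball (0 : ℂ) 1 := by simpa using ha1
    have h7 : 0 < 1 - ‖a n‖ ^ 2 := by nlinarith [norm_nonneg (a n)]
    have hT : (volterraOp lam hg hmap u : ℂ → ℂ) = volterra g (f n) := rfl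
    have hdT := hasDerivAt_volterra hg (hfmem n).1.1 hball
    have hdK := (HolDisc.differentiableAt (K u).2.1.1 hball)
    have hdh := (HolDisc.differentiableAt h.2.1.1 hball)
    have h1 : ENNReal.ofReal ((1 - ‖a n‖ ^ 2) * ‖deriv (volterra g (f n) - (K u : ℂ → ℂ)) (a n)‖)
        ≤ N := by
      refine (ofReal_deriv_le_blochNorm _ hball).trans ?_
      exact le_iSup₂ (f := fun (f : LittleMorrey lam) (_ : morreyNorm lam f ≤ 1) =>
        blochNorm ((volterraOp lam hg hmap - K) f)) u (hfn n)
    have h2 := ofReal_deriv_le_blochNorm ((K u : ℂ → ℂ) - (h : ℂ → ℂ)) hball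
    have h3 : b * k ≤ ENNReal.ofReal ((1 - ‖a n‖ ^ 2) * ‖deriv (volterra g (f n)) (a n)‖) := by
      refine (mul_le_mul_left hWb.le _).trans (le_of_eq ?_)
      rw [blochMorreyWeight, ← ENNReal.ofReal_coe_nnreal, ← ENNReal.ofReal_mul (by positivity),
        hdT.deriv, norm_mul, hfa n]
      congr 1
      have e : (1 - ‖a n‖ ^ 2) ^ ((1 + lam) / 2) =
          (1 - ‖a n‖ ^ 2) * (1 - ‖a n‖ ^ 2) ^ (-((1 - lam) / 2)) := by
        conv_rhs => enter [1]; rw [← Real.rpow_one (1 - ‖a n‖ ^ 2)]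
        rw [← Real.rpow_add h7]
        ring_nf
      rw [e]
      ring
    refine h3.trans ?_
    refine le_trans ?_ (add_le_add h1 (add_le_add_left h2 _))
    rw [← ENNReal.ofReal_add (by positivity) (by positivity),
      ← ENNReal.ofReal_add (by positivity) (by positivity)]
    refine ENNReal.ofReal_le_ofReal ?_
    rw [← mul_add, ← mul_add]
    refine mul_le_mul_of_nonneg_left ?_ h7.le
    rw [deriv_sub hdT.differentiableAt hdK, deriv_sub hdK hdh]
    have e1 := norm_add_le (deriv (volterra g (f n)) (a n) - deriv (K u : ℂ → ℂ) (a n))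
      (deriv (K u : ℂ → ℂ) (a n) - deriv (h : ℂ → ℂ) (a n) + deriv (h : ℂ → ℂ) (a n))
    have e2 := norm_add_le (deriv (K u : ℂ → ℂ) (a n) - deriv (h : ℂ → ℂ) (a n))
      (deriv (h : ℂ → ℂ) (a n))
    rw [sub_add_cancel] at e1 e2
    rw [sub_add_cancel] at e1
    linarith
  have hlim2 : Tendsto (fun j => N + (blochNorm (K ⟨f (s j), hfmem (s j)⟩ - h) +
      ENNReal.ofReal ((1 - ‖a (s j)‖ ^ 2) * ‖deriv (h : ℂ → ℂ) (a (s j))‖))) atTop (𝓝 N) := by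
    have h1 := ENNReal.tendsto_ofReal (h.2.2.comp (ha.comp hs.tendsto_atTop))
    rw [ENNReal.ofReal_zero] at h1
    have h2 := (hlim.add h1).const_add N
    rwa [add_zero, add_zero] at h2
  have hfin : b * k ≤ N := ge_of_tendsto' hlim2 hbound
  rw [ENNReal.div_lt_iff (Or.inl hk0') (Or.inl ENNReal.coe_ne_top)] at hb1
  exact absurd hfin (not_le.2 hb1)

/-! ### Growth of functions in the Morrey unit ball -/

/-- Rotating by -c first makes the principal argument the signed angular distance from the centre,
so the branch cut does no harm. -/
theorem mem_carlesonBox_of_abs_arg_le {z : ℂ} {c l : ℝ} (h1 : 1 - l ≤ ‖z‖) (h2 : ‖z‖ < 1)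
    (h3 : |(z * Complex.exp (-(c * Complex.I))).arg| ≤ π * l) : z ∈ carlesonBox c l := by
  refine ⟨h1, h2, c + (z * Complex.exp (-(c * Complex.I))).arg, ?_, ?_⟩
  · rw [abs_le] at h3
    constructor <;> linarith [h3.1, h3.2]
  · have hn : ‖z * Complex.exp (-(c * Complex.I))‖ = ‖z‖ := by
      rw [norm_mul, show -(c * Complex.I) = ((-c : ℝ) : ℂ) * Complex.I by push_cast; ring,
        Complex.norm_exp_ofReal_mul_I, mul_one]
    have h := Complex.norm_mul_exp_arg_mul_I (z * Complex.exp (-(c * Complex.I)))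
    rw [hn] at h
    rw [polarPt]
    push_cast
    rw [add_mul, Complex.exp_add, mul_left_comm, h, mul_left_comm, ← Complex.exp_add,
      add_neg_cancel, Complex.exp_zero, mul_one]

theorem ball_subset_carlesonBox {a : ℂ} (ha : ‖a‖ < 1) :
    Metric.ball a ((1 - ‖a‖) / 2) ⊆ carlesonBox a.arg (min 1 (2 * (1 - ‖a‖))) := by
  intro z hz
  set d := 1 - ‖a‖ with hd
  have hd0 : 0 < d := by linarith
  have h1 : ‖z - a‖ < d / 2 := by simpa [dist_eq_norm] using hz
  have h2 := norm_add_le (z - a) a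
  rw [sub_add_cancel] at h2
  have h3 := norm_sub_norm_le a z
  rw [norm_sub_rev] at h3
  refine mem_carlesonBox_of_abs_arg_le ?_ (by linarith) ?_
  · rcases min_choice 1 (2 * d) with h | h <;> rw [h]
    · linarith [norm_nonneg z]
    · linarith
  -- If 2d ≥ 1 the arc is the full circle. Otherwise |a| > 1/2, the rotated point w has real part at
  -- least 1/4, and Jordan's inequality for sin(arg w) = Im w/|w| gives |arg w| ≤ πd.
  rcases le_or_gt 1 (2 * d) with h4 | h4
  · rw [min_eq_left h4, mul_one]
    exact Complex.abs_arg_le_pi _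
  rw [min_eq_right h4.le]
  set w := z * Complex.exp (-(a.arg * Complex.I)) with hw
  have hwa : ‖w - (‖a‖ : ℂ)‖ < d / 2 := by
    have e : w - (‖a‖ : ℂ) = (z - a) * Complex.exp (-(a.arg * Complex.I)) := by
      have e1 : (‖a‖ : ℂ) = a * Complex.exp (-(a.arg * Complex.I)) := by
        conv_rhs => enter [1]; rw [← Complex.norm_mul_exp_arg_mul_I a]
        rw [mul_assoc, ← Complex.exp_add, add_neg_cancel, Complex.exp_zero, mul_one]
      rw [hw, sub_mul, ← e1]
    rw [e, norm_mul, show -(a.arg * Complex.I) = ((-a.arg : ℝ) : ℂ) * Complex.I by push_cast; ring,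
        Complex.norm_exp_ofReal_mul_I, mul_one]
    exact h1
  have hre := (Complex.abs_re_le_norm _).trans_lt hwa
  have him := (Complex.abs_im_le_norm _).trans_lt hwa
  simp only [Complex.sub_re, Complex.sub_im, Complex.ofReal_re, Complex.ofReal_im, sub_zero] at hre him
  rw [abs_lt] at hre
  have hre' : 1 / 4 ≤ w.re := by linarith [hre.1]
  have hwn : 1 / 4 ≤ ‖w‖ := hre'.trans ((le_abs_self _).trans (Complex.abs_re_le_norm w))
  have harg := Real.mul_abs_le_abs_sin (Complex.abs_arg_le_pi_div_two_iff.2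
    (by linarith : 0 ≤ w.re))
  rw [Complex.sin_arg, abs_div, abs_norm, le_div_iff₀ (by linarith)] at harg
  have hpi := Real.pi_pos
  have h5 : 2 / π * |w.arg| * (1 / 4) ≤ d / 2 :=
    (mul_le_mul_of_nonneg_left hwn (by positivity)).trans (harg.trans him.le)
  have h6 : |w.arg| = 2 / π * |w.arg| * (1 / 4) * (2 * π) := by field_simp; norm_num
  rw [h6]
  nlinarith

/-- The disc of radius d/2 about `a` lies in a box of size at most 2d. The sub-mean value property
there gives (d/2)³|f'(a)|² ≤ (2d)^λ ≤ 2d^λ, hence |f'(a)|² ≤ 16 d^{λ-3}. -/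
theorem norm_deriv_le_of_morreyNorm_le_one {lam : ℝ} (hlam0 : 0 < lam) (hlam1 : lam < 1)
    {f : ℂ → ℂ} (hf : f ∈ HolDisc) (hn : morreyNorm lam f ≤ 1) {a : ℂ} (ha : ‖a‖ < 1) :
    ‖deriv f a‖ ≤ 4 * (1 - ‖a‖) ^ (-((1 - lam) / 2) - 1) := by
  have hsubbox := ball_subset_carlesonBox ha
  set d := 1 - ‖a‖ with hd
  have hd0 : 0 < d := by linarith
  set l := min 1 (2 * d) with hl
  have hl0 : 0 < l := lt_min one_pos (by positivity)
  have hball : ∀ z ∈ Metric.ball a (d / 2), ‖z‖ < 1 - d / 2 := by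
    intro z hz
    have h1 : ‖z - a‖ < d / 2 := by simpa [dist_eq_norm] using hz
    have h2 := norm_add_le (z - a) a
    rw [sub_add_cancel] at h2
    linarith
  have hsub : Metric.ball a (d / 2) ⊆ Metric.ball 0 1 := fun z hz => by
    have := hball z hz
    rw [mem_ball_zero_iff]; linarith
  have hmean := normSq_center_le_lintegral_ball (a := a) (r := d / 2) (by positivity)
    ((hf.1.deriv Metric.isOpen_ball).mono hsub)
  have hbox : ∫⁻ z in carlesonBox a.arg l, ENNReal.ofReal (‖deriv f z‖ ^ 2 * (1 - ‖z‖ ^ 2))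
      ∂discMeasure ≤ ENNReal.ofReal (l ^ lam) := by
    have h1 := ((le_iSup_of_le a.arg (le_iSup₂_of_le l ⟨hl0, min_le_left _ _⟩ le_rfl)).trans
      le_add_self).trans hn
    rw [← ENNReal.one_rpow (1 / 2), ENNReal.rpow_le_rpow_iff (by norm_num), mul_comm, ← div_eq_mul_inv] at h1
    have h2 := (ENNReal.div_le_iff (by simp; positivity) ENNReal.ofReal_ne_top).1 h1
    rwa [one_mul] at h2
  have hlow : ENNReal.ofReal ((d / 2) ^ 3) * ‖deriv f a‖ₑ ^ 2 ≤
      ∫⁻ z in carlesonBox a.arg l, ENNReal.ofReal (‖deriv f z‖ ^ 2 * (1 - ‖z‖ ^ 2))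
      ∂discMeasure := by
    refine le_trans ?_ (lintegral_mono_set hsubbox)
    rw [discMeasure, Measure.restrict_smul, lintegral_smul_measure,
      Measure.restrict_restrict Metric.isOpen_ball.measurableSet, inter_eq_left.2 hsub, smul_eq_mul]
    calc _ = ENNReal.ofReal π⁻¹ * (ENNReal.ofReal (d / 2) *
          (ENNReal.ofReal (π * (d / 2) ^ 2) * ‖deriv f a‖ₑ ^ 2)) := by
          rw [← mul_assoc (ENNReal.ofReal (d / 2)), ← ENNReal.ofReal_mul (by positivity),
            ← mul_assoc, ← ENNReal.ofReal_mul (by positivity)]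
          congr 2
          field_simp
      _ ≤ ENNReal.ofReal π⁻¹ * (ENNReal.ofReal (d / 2) *
          ∫⁻ z in Metric.ball a (d / 2), ‖deriv f z‖ₑ ^ 2) := by gcongr
      _ ≤ _ := by
        gcongr
        rw [← lintegral_const_mul' _ _ ENNReal.ofReal_ne_top]
        refine setLIntegral_mono' Metric.isOpen_ball.measurableSet fun z hz => ?_
        rw [← ofReal_norm, ← ENNReal.ofReal_pow (norm_nonneg _),
          ← ENNReal.ofReal_mul (by positivity)]
        refine ENNReal.ofReal_le_ofReal ?_
        have h1 := hball z hz
        rw [mul_comm]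
        gcongr
        nlinarith [norm_nonneg z]
  have hreal := hlow.trans hbox
  rw [← ofReal_norm, ← ENNReal.ofReal_pow (norm_nonneg _), ← ENNReal.ofReal_mul (by positivity),
    ENNReal.ofReal_le_ofReal_iff (by positivity)] at hreal
  have hll : l ^ lam ≤ 2 * d ^ lam := by
    calc l ^ lam ≤ (2 * d) ^ lam := by
          gcongr
          exact min_le_right _ _
      _ = 2 ^ lam * d ^ lam := Real.mul_rpow (by norm_num) hd0.le
      _ ≤ 2 ^ (1 : ℝ) * d ^ lam := by
          gcongr
          norm_num
      _ = _ := by rw [Real.rpow_one]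
  have hsq : (d ^ (-((1 - lam) / 2) - 1)) ^ 2 = d ^ lam / d ^ 3 := by
    rw [← Real.rpow_two, ← Real.rpow_mul hd0.le, ← Real.rpow_natCast d 3, ← Real.rpow_sub hd0]
    congr 1
    push_cast
    ring
  refine le_of_sq_le_sq ?_ (by positivity)
  rw [mul_pow, hsq, ← mul_div_assoc, le_div_iff₀ (by positivity)]
  nlinarith

/-- Radial integration of the derivative bound, done by comparing |f(tz)| with 1 +
(4/b)(1-t|z|)^{-b}; here 4/b = 8/(1-λ), and the 1 covers |f(0)|. -/
theorem norm_le_of_morreyNorm_le_one {lam : ℝ} (hlam0 : 0 < lam) (hlam1 : lam < 1)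
    {f : ℂ → ℂ} (hf : f ∈ HolDisc) (hn : morreyNorm lam f ≤ 1) {z : ℂ} (hz : ‖z‖ < 1) :
    ‖f z‖ ≤ (1 + 8 / (1 - lam)) * (1 - ‖z‖) ^ (-((1 - lam) / 2)) := by
  set b := (1 - lam) / 2 with hb
  have hb0 : 0 < b := by rw [hb]; linarith
  have hpos : ∀ t ∈ Icc (0 : ℝ) 1, 0 < 1 - t * ‖z‖ := fun t ht => by
    nlinarith [ht.1, ht.2, norm_nonneg z]
  have hnorm : ∀ t ∈ Icc (0 : ℝ) 1, ‖(t : ℂ) * z‖ = t * ‖z‖ := fun t ht => by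
    rw [norm_mul, Complex.norm_real, Real.norm_of_nonneg ht.1]
  have hder : ∀ t ∈ Icc (0 : ℝ) 1, HasDerivAt (fun t : ℝ => f (t * z)) (deriv f (t * z) * z) t := by
    intro t ht
    have h1 : HasDerivAt (fun t : ℝ => (t : ℂ) * z) z t := by
      simpa using (Complex.ofRealCLM.hasDerivAt (x := t)).mul_const z
    refine (HolDisc.differentiableAt hf ?_).hasDerivAt.comp t h1
    rw [mem_ball_zero_iff, hnorm t ht]
    linarith [hpos t ht]
  have hderB : ∀ t ∈ Icc (0 : ℝ) 1, HasDerivAt (fun t : ℝ => 1 + 4 / b * (1 - t * ‖z‖) ^ (-b))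
      (4 * ‖z‖ * (1 - t * ‖z‖) ^ (-b - 1)) t := by
    intro t ht
    have h1 : HasDerivAt (fun t : ℝ => 1 - t * ‖z‖) (-‖z‖) t := by
      simpa using ((hasDerivAt_id t).mul_const ‖z‖).const_sub 1
    refine (((h1.rpow_const (p := -b) (Or.inl (hpos t ht).ne')).const_mul (4 / b)).const_add
      1).congr_deriv ?_
    field_simp
  have hf0 : ‖f 0‖ ≤ 1 := by
    have h1 := le_self_add.trans hn
    rwa [← ofReal_norm, ENNReal.ofReal_le_one] at h1
  have key := image_norm_le_of_norm_deriv_right_le_deriv_boundary'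
    (f := fun t : ℝ => f (t * z)) (a := 0) (b := 1)
    (fun t ht => (hder t ht).continuousAt.continuousWithinAt)
    (fun t ht => (hder t (Ico_subset_Icc_self ht)).hasDerivWithinAt)
    (B := fun t : ℝ => 1 + 4 / b * (1 - t * ‖z‖) ^ (-b)) (by simp; linarith [div_pos four_pos hb0])
    (fun t ht => (hderB t ht).continuousAt.continuousWithinAt)
    (fun t ht => (hderB t (Ico_subset_Icc_self ht)).hasDerivWithinAt) (fun t ht => by
      have ht' := Ico_subset_Icc_self ht
      have h1 := norm_deriv_le_of_morreyNorm_le_one hlam0 hlam1 hf hn (a := t * z)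
        (by rw [hnorm t ht']; linarith [hpos t ht'])
      rw [hnorm t ht'] at h1
      rw [norm_mul]
      nlinarith [norm_nonneg z])
  have h1 := key (right_mem_Icc.2 zero_le_one)
  simp only [Complex.ofReal_one, one_mul] at h1
  have h2 : 1 ≤ (1 - ‖z‖) ^ (-b) :=
    Real.one_le_rpow_of_pos_of_le_one_of_nonpos (by linarith) (by linarith [norm_nonneg z])
      (by linarith)
  have h3 : 8 / (1 - lam) = 4 / b := by
    rw [hb]; field_simp; norm_num
  rw [h3, add_mul, one_mul]
  linarith

/-! ### Finite-rank approximation by Taylor polynomials of dilations -/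

theorem blochNorm_sum_smul_le (s : Finset ℕ) (a : ℕ → ℂ) (y : ℕ → LittleBloch) :
    blochNorm (∑ k ∈ s, a k • y k : LittleBloch) ≤
      ∑ k ∈ s, ‖a k‖ₑ * blochNorm (y k : ℂ → ℂ) := by
  classical
  induction s using Finset.induction_on with
  | empty => simp [blochNorm]
  | insert k s hk ih =>
    rw [Finset.sum_insert hk, Finset.sum_insert hk]
    refine (blochNorm_add_le (SetLike.coe_mem (a k • y k)).1.1
      (SetLike.coe_mem (∑ k ∈ s, a k • y k)).1.1).trans (add_le_add ?_ ih)
    exact blochNorm_smul_le _ (y k).2.1.1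

theorem isCompactOp_sum_smulRight {NX : (ℂ → ℂ) → ℝ≥0∞} {X : Submodule ℂ (ℂ → ℂ)} (N : ℕ)
    (c : ℕ → X →ₗ[ℂ] ℂ) (B : ℕ → ℝ) (hc : ∀ k, ∀ f : X, NX f ≤ 1 → ‖c k f‖ ≤ B k)
    (y : ℕ → LittleBloch) :
    IsCompactOp NX blochNorm (∑ k ∈ Finset.range N, (c k).smulRight (y k)) := by
  intro u hu
  -- Compactness of a product of closed discs yields one subsequence along which all coefficients
  -- converge.
  obtain ⟨x, -, s, hs, hx⟩ := (isCompact_univ_pi fun k : ℕ =>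
    isCompact_closedBall (0 : ℂ) (B k)).tendsto_subseq (x := fun n k => c k (u n)) fun n k _ => by
      simpa using hc k (u n) (hu n)
  refine ⟨∑ k ∈ Finset.range N, x k • y k, s, hs, ?_⟩
  have hlim : Tendsto (fun j => ∑ k ∈ Finset.range N,
      ‖c k (u (s j)) - x k‖ₑ * blochNorm (y k : ℂ → ℂ)) atTop (𝓝 0) := by
    rw [← Finset.sum_const_zero (ι := ℕ) (s := Finset.range N)]
    refine tendsto_finsetSum _ fun k _ => ?_
    have h1 : Tendsto (fun j => c k (u (s j)) - x k) atTop (𝓝 0) := by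
      simpa using ((tendsto_pi_nhds.1 hx k).sub_const (x k))
    have h2 := ENNReal.Tendsto.mul_const (b := blochNorm (y k : ℂ → ℂ)) h1.enorm
      (Or.inr (y k).2.1.2.ne)
    simpa using h2
  refine tendsto_of_tendsto_of_tendsto_of_le_of_le tendsto_const_nhds hlim
    (fun _ => zero_le) fun j => ?_
  refine le_trans (le_of_eq ?_)
    (blochNorm_sum_smul_le (Finset.range N) (fun k => c k (u (s j)) - x k) y)
  congr 1
  rw [← AddSubgroupClass.coe_sub]
  congr 1
  rw [LinearMap.sum_apply, ← Finset.sum_sub_distrib]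
  exact Finset.sum_congr rfl fun k _ => (sub_smul _ _ _).symm

theorem HolDisc.contDiffAt_zero {f : ℂ → ℂ} (hf : f ∈ HolDisc) (n : WithTop ℕ∞) :
    ContDiffAt ℂ n f 0 :=
  (hf.1.analyticAt (Metric.isOpen_ball.mem_nhds (by simp))).contDiffAt

/-- The `k`-th Taylor coefficient at `0`, as a linear functional. -/
noncomputable def taylorCoeff (lam : ℝ) (k : ℕ) : LittleMorrey lam →ₗ[ℂ] ℂ where
  toFun f := (k.factorial : ℂ)⁻¹ * iteratedDeriv k (f : ℂ → ℂ) 0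
  map_add' f h := by
    rw [Submodule.coe_add, iteratedDeriv_add (HolDisc.contDiffAt_zero f.2.1.1 _)
      (HolDisc.contDiffAt_zero h.2.1.1 _), mul_add]
  map_smul' a f := by
    have h : iteratedDeriv k ((a • f : LittleMorrey lam) : ℂ → ℂ) 0 =
        a • iteratedDeriv k (f : ℂ → ℂ) 0 := iteratedDeriv_const_smul_field a _
    rw [h, smul_eq_mul, RingHom.id_apply, smul_eq_mul]
    ring

theorem norm_taylorCoeff_le {lam : ℝ} (f : LittleMorrey lam) (k : ℕ) {ρ M : ℝ} (hρ0 : 0 < ρ)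
    (hρ1 : ρ < 1) (hM : ∀ z : ℂ, ‖z‖ = ρ → ‖(f : ℂ → ℂ) z‖ ≤ M) :
    ‖taylorCoeff lam k f‖ ≤ M / ρ ^ k := by
  have h := Complex.norm_iteratedDeriv_le_of_forall_mem_sphere_norm_le (f := (f : ℂ → ℂ)) (c := 0)
    k hρ0 ((f.2.1.1.1.mono (Metric.closedBall_subset_ball hρ1)).diffContOnCl_ball subset_rfl)
    (fun z hz => hM z (by simpa using hz))
  have hk : (0 : ℝ) < k.factorial := by exact_mod_cast k.factorial_pos
  change ‖(k.factorial : ℂ)⁻¹ * iteratedDeriv k (f : ℂ → ℂ) 0‖ ≤ _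
  rw [norm_mul, norm_inv, Complex.norm_natCast, inv_mul_le_iff₀ hk]
  rwa [mul_div_assoc] at h

/-- The monomial `z ^ k` as an element of `𝓛^{2,λ}_0`. -/
noncomputable def monomialLM {lam : ℝ} (hlam : lam < 1) (k : ℕ) : LittleMorrey lam :=
  ⟨(Metric.ball (0 : ℂ) 1).indicator fun z => z ^ k,
    indicator_ball_mem_littleMorrey hlam one_lt_two (differentiableOn_pow k)⟩

/-- The `N`-th Taylor polynomial of `z ↦ f (r z)`. -/
noncomputable def taylorDilation {lam : ℝ} (hlam : lam < 1) (r : ℝ) (N : ℕ) :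
    LittleMorrey lam →ₗ[ℂ] LittleMorrey lam :=
  ∑ k ∈ Finset.range N, ((r : ℂ) ^ k • taylorCoeff lam k).smulRight (monomialLM hlam k)

theorem taylorDilation_apply {lam : ℝ} (hlam : lam < 1) (r : ℝ) (N : ℕ) (f : LittleMorrey lam)
    {z : ℂ} (hz : ‖z‖ < 1) : (taylorDilation hlam r N f : ℂ → ℂ) z =
      ∑ k ∈ Finset.range N, taylorCoeff lam k f * (r * z) ^ k := by
  rw [taylorDilation, LinearMap.sum_apply, Submodule.coe_sum, Finset.sum_apply]
  refine Finset.sum_congr rfl fun k _ => ?_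
  rw [LinearMap.smulRight_apply, Submodule.coe_smul, Pi.smul_apply, monomialLM]
  dsimp only
  rw [indicator_of_mem (by simpa using hz)]
  simp only [LinearMap.smul_apply, smul_eq_mul, mul_pow]
  ring

/-- Insert f(rz) between f and the polynomial. The choice of r controls f(z)-f(rz) on |z| ≤ R, the
choice of N controls the Taylor tail on the whole disc, and both are uniform over the unit ball. In
the global bound f and its dilation contribute D each and the tail contributes 1. -/
theorem exists_taylorDilation_approx {lam : ℝ} (hlam0 : 0 < lam) (hlam1 : lam < 1) :
    ∃ D : ℝ, 0 < D ∧ ∀ R, 0 < R → R < 1 → ∀ ε, 0 < ε → ∃ (r : ℝ) (N : ℕ),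
      ∀ f : LittleMorrey lam, morreyNorm lam f ≤ 1 →
        (∀ z : ℂ, ‖z‖ ≤ R → ‖(f - taylorDilation hlam1 r N f : ℂ → ℂ) z‖ ≤ ε) ∧
        ∀ z : ℂ, ‖z‖ < 1 → ‖(f - taylorDilation hlam1 r N f : ℂ → ℂ) z‖ ≤
          D * (1 - ‖z‖) ^ (-((1 - lam) / 2)) := by
  set b := (1 - lam) / 2 with hb
  have hb0 : 0 < b := by rw [hb]; linarith
  set D := 1 + 8 / (1 - lam) with hD
  have hD0 : 0 < D := by
    have : 0 < 1 - lam := by linarith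
    positivity
  refine ⟨2 * D + 1, by positivity, fun R hR0 hR1 ε hε => ?_⟩
  set G := 4 * (1 - R) ^ (-b - 1) with hG
  have hG0 : 0 < G := by
    have : 0 < 1 - R := by linarith
    positivity
  set r := 1 - min (1 / 2) (ε / (2 * G)) with hr
  have hr0 : 0 < r := by linarith [min_le_left (1 / 2) (ε / (2 * G))]
  have hr1 : r < 1 := by
    have : 0 < min (1 / 2) (ε / (2 * G)) := by positivity
    linarith
  have hrε : G * (1 - r) ≤ ε / 2 := by
    have h1 : 1 - r ≤ ε / (2 * G) := by
      rw [hr, sub_sub_cancel]; exact min_le_right _ _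
    calc _ ≤ G * (ε / (2 * G)) := by gcongr
      _ = _ := by field_simp
  -- A radius strictly between r and 1: Cauchy's estimates on |w| = ρ make the Taylor series at rz
  -- geometric with ratio r/ρ < 1 for every |z| < 1.
  set ρ := (1 + r) / 2 with hρ
  have hρ0 : 0 < ρ := by linarith
  have hρ1 : ρ < 1 := by linarith
  set M := D * (1 - ρ) ^ (-b) with hM
  have hM0 : 0 < M := by
    have : 0 < 1 - ρ := by linarith
    positivity
  set x := r / ρ with hx
  have hx0 : 0 < x := by positivity
  have hx1 : x < 1 := by rw [hx, div_lt_one hρ0]; linarith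
  have hx2 : 0 < 1 - x := by linarith
  obtain ⟨N, hN⟩ := exists_pow_lt_of_lt_one
    (show 0 < min (ε / 2) 1 * (1 - x) / M by positivity) hx1
  refine ⟨r, N, fun f hf => ?_⟩
  have hfH := f.2.1.1
  have hfg : ∀ z : ℂ, ‖z‖ < 1 → ‖(f : ℂ → ℂ) z‖ ≤ D * (1 - ‖z‖) ^ (-b) := fun z hz =>
    norm_le_of_morreyNorm_le_one hlam0 hlam1 hfH hf hz
  have hrz : ∀ z : ℂ, ‖(r : ℂ) * z‖ = r * ‖z‖ := fun z => by
    rw [norm_mul, Complex.norm_real, Real.norm_of_nonneg hr0.le]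
  have htail : ∀ z : ℂ, ‖z‖ < 1 →
      ‖(f : ℂ → ℂ) (r * z) - (taylorDilation hlam1 r N f : ℂ → ℂ) z‖ ≤ min (ε / 2) 1 := by
    intro z hz
    have hmem : (r : ℂ) * z ∈ Metric.ball (0 : ℂ) 1 := by
      rw [mem_ball_zero_iff, hrz]
      nlinarith [norm_nonneg z]
    have hsum := Complex.hasSum_taylorSeries_on_ball hfH.1 hmem
    have hsum' : HasSum (fun k => taylorCoeff lam k f * (r * z) ^ k) ((f : ℂ → ℂ) (r * z)) := by
      refine hsum.congr_fun fun k => ?_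
      change (k.factorial : ℂ)⁻¹ * iteratedDeriv k (f : ℂ → ℂ) 0 * _ = _
      simp only [smul_eq_mul, sub_zero]
      ring
    have hgeo := norm_sub_le_of_geometric_bound_of_hasSum (C := M) hx1 (fun k => by
      rw [norm_mul, norm_pow, hrz]
      have h1 := norm_taylorCoeff_le f k hρ0 hρ1 (M := M) (fun w hw => by
        have := hfg w (by rw [hw]; exact hρ1)
        rwa [hw] at this)
      calc _ ≤ M / ρ ^ k * (r * 1) ^ k := by gcongr
        _ = M * x ^ k := by rw [hx, div_pow r ρ k, mul_one, div_mul_eq_mul_div, mul_div_assoc]) hsum' N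
    rw [taylorDilation_apply hlam1 r N f hz, norm_sub_rev]
    refine hgeo.trans ?_
    rw [div_le_iff₀ hx2]
    rw [lt_div_iff₀ hM0] at hN
    linarith
  constructor
  · intro z hz
    have h1 := (convex_closedBall (0 : ℂ) R).norm_image_sub_le_of_norm_deriv_le
      (f := (f : ℂ → ℂ)) (C := G) (x := r * z) (y := z)
      (fun w hw => HolDisc.differentiableAt hfH (Metric.closedBall_subset_ball hR1 hw))
      (fun w hw => by
        have hw' : ‖w‖ ≤ R := by simpa using hw
        refine (norm_deriv_le_of_morreyNorm_le_one hlam0 hlam1 hfH hf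
          (hw'.trans_lt hR1)).trans ?_
        rw [hG]
        gcongr 4 * ?_
        exact Real.rpow_le_rpow_of_nonpos (by linarith) (by linarith) (by linarith))
      (by rw [mem_closedBall_zero_iff, hrz]; nlinarith [norm_nonneg z]) (by simpa using hz)
    have h2 : ‖z - r * z‖ ≤ 1 - r := by
      rw [show z - r * z = ((1 - r : ℝ) : ℂ) * z by push_cast; ring, norm_mul, Complex.norm_real,
        Real.norm_of_nonneg (by linarith)]
      nlinarith [norm_nonneg z]
    have h3 := htail z (by linarith)
    have h4 := norm_add_le ((f : ℂ → ℂ) z - (f : ℂ → ℂ) (r * z))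
      ((f : ℂ → ℂ) (r * z) - (taylorDilation hlam1 r N f : ℂ → ℂ) z)
    rw [sub_add_sub_cancel] at h4
    have h5 : G * ‖z - r * z‖ ≤ G * (1 - r) := by gcongr
    rw [Pi.sub_apply]
    linarith [min_le_left (ε / 2) 1]
  · intro z hz
    have h1 := hfg z hz
    have hz' : r * ‖z‖ ≤ ‖z‖ := by nlinarith [norm_nonneg z]
    have h2 : ‖(f : ℂ → ℂ) (r * z)‖ ≤ D * (1 - ‖z‖) ^ (-b) := by
      refine (hfg (r * z) (by rw [hrz]; linarith)).trans ?_
      gcongr D * ?_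
      rw [hrz]
      exact Real.rpow_le_rpow_of_nonpos (by linarith) (by linarith) (by linarith)
    have h3 := htail z hz
    have h4 := norm_sub_le ((f : ℂ → ℂ) z) ((f : ℂ → ℂ) (r * z))
    have h5 := norm_add_le ((f : ℂ → ℂ) z - (f : ℂ → ℂ) (r * z))
      ((f : ℂ → ℂ) (r * z) - (taylorDilation hlam1 r N f : ℂ → ℂ) z)
    rw [sub_add_sub_cancel] at h5
    have h6 : 1 ≤ (1 - ‖z‖) ^ (-b) :=
      Real.one_le_rpow_of_pos_of_le_one_of_nonpos (by linarith) (by linarith [norm_nonneg z])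
        (by linarith)
    rw [Pi.sub_apply]
    linarith [min_le_right (ε / 2) 1]

/-! ### The upper bound for the essential norm -/

theorem isCompactOp_volterraOp_comp_taylorDilation {lam : ℝ} (hlam0 : 0 < lam) (hlam1 : lam < 1)
    {g : ℂ → ℂ} (hg : DifferentiableOn ℂ g (Metric.ball 0 1))
    (hmap : ∀ f ∈ LittleMorrey lam, volterra g f ∈ LittleBloch) (r : ℝ) (N : ℕ) :
    IsCompactOp (morreyNorm lam) blochNorm
      (volterraOp lam hg hmap ∘ₗ taylorDilation hlam1 r N) := by
  have h : volterraOp lam hg hmap ∘ₗ taylorDilation hlam1 r N =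
      ∑ k ∈ Finset.range N, ((r : ℂ) ^ k • taylorCoeff lam k).smulRight
        (volterraOp lam hg hmap (monomialLM hlam1 k)) := by
    refine LinearMap.ext fun f => ?_
    rw [LinearMap.comp_apply, taylorDilation, LinearMap.sum_apply, LinearMap.sum_apply, map_sum]
    refine Finset.sum_congr rfl fun k _ => ?_
    rw [LinearMap.smulRight_apply, LinearMap.smulRight_apply, map_smul]
  rw [h]
  refine isCompactOp_sum_smulRight N _ (fun k => ‖(r : ℂ) ^ k‖ *
    ((1 + 8 / (1 - lam)) * (1 - 1 / 2) ^ (-((1 - lam) / 2)) / (1 / 2) ^ k)) (fun k f hf => ?_) _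
  rw [LinearMap.smul_apply, norm_smul]
  gcongr
  refine norm_taylorCoeff_le f k (by norm_num) (by norm_num) fun z hz => ?_
  have h1 := norm_le_of_morreyNorm_le_one hlam0 hlam1 f.2.1.1 hf (z := z) (by rw [hz]; norm_num)
  rwa [hz] at h1

theorem essNorm_le_limsup_blochMorreyWeight {lam : ℝ} (hlam0 : 0 < lam) (hlam1 : lam < 1) :
    ∃ C : ℝ≥0, 0 < C ∧ ∀ (g : ℂ → ℂ) (hg : DifferentiableOn ℂ g (Metric.ball 0 1))
      (hmap : ∀ f ∈ LittleMorrey lam, volterra g f ∈ LittleBloch),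
      essNormOf (morreyNorm lam) blochNorm (volterraOp lam hg hmap) ≤
        C * limsup (blochMorreyWeight lam g) toBoundary := by
  obtain ⟨D, hD0, hD⟩ := exists_taylorDilation_approx hlam0 hlam1
  set C : ℝ≥0 := ⟨2 * D, by positivity⟩ with hC
  have hCpos : 0 < C := show 0 < 2 * D by positivity
  have hC0 : (C : ℝ≥0∞) ≠ 0 := by exact_mod_cast hCpos.ne'
  refine ⟨C, hCpos, fun g hg hmap => le_of_forall_gt fun c hc => ?_⟩
  rw [mul_comm, ← ENNReal.lt_div_iff_mul_lt (Or.inl hC0) (Or.inl ENNReal.coe_ne_top)] at hc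
  obtain ⟨b, hb1, hb2⟩ := ENNReal.lt_iff_exists_nnreal_btwn.1 hc
  rw [ENNReal.lt_div_iff_mul_lt (Or.inl hC0) (Or.inl ENNReal.coe_ne_top)] at hb2
  refine lt_of_le_of_lt ?_ hb2
  have hb0 : (0 : ℝ) < b := by
    have : (0 : ℝ≥0∞) < b := zero_le.trans_lt hb1
    exact_mod_cast this
  obtain ⟨R, hR0, hR1, hR⟩ := exists_forall_of_eventually_toBoundary
    (eventually_lt_of_limsup_lt hb1)
  -- Applying T_g to the constant 1 shows that (1-|z|²)|g'(z)| is bounded, which is what the region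
  -- |z| ≤ R requires.
  have hone := hmap _ (monomialLM hlam1 0).2
  set G := (blochNorm (volterra g (monomialLM hlam1 0 : ℂ → ℂ))).toReal with hG
  have hG0 : 0 ≤ G := ENNReal.toReal_nonneg
  have hgG : ∀ z : ℂ, ‖z‖ < 1 → (1 - ‖z‖ ^ 2) * ‖deriv g z‖ ≤ G := by
    intro z hz
    have hzb : z ∈ Metric.ball (0 : ℂ) 1 := by simpa using hz
    have h1 := ofReal_deriv_le_blochNorm (volterra g (monomialLM hlam1 0 : ℂ → ℂ)) hzb
    rw [(hasDerivAt_volterra hg (monomialLM hlam1 0).2.1.1 hzb).deriv, monomialLM] at h1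
    dsimp only at h1
    rw [indicator_of_mem hzb, pow_zero, one_mul] at h1
    exact (ENNReal.ofReal_le_iff_le_toReal hone.1.2.ne).1 h1
  -- Chosen so that ε(G+1) = 2Db, the bound obtained for |z| > R; G+1 avoids division by zero.
  set ε := 2 * D * b / (G + 1) with hε
  have hε0 : 0 < ε := by positivity
  obtain ⟨r, N, hrN⟩ := hD R hR0 hR1 ε hε0
  refine (iInf₂_le _ (isCompactOp_volterraOp_comp_taylorDilation hlam0 hlam1 hg hmap r N)).trans ?_
  refine iSup₂_le fun f hf => ?_
  obtain ⟨hf1, hf2⟩ := hrN f hf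
  set u : LittleMorrey lam := f - taylorDilation hlam1 r N f with hu
  have hTu : ((volterraOp lam hg hmap - volterraOp lam hg hmap ∘ₗ taylorDilation hlam1 r N) f :
      ℂ → ℂ) = volterra g u := by
    rw [LinearMap.sub_apply, LinearMap.comp_apply, ← map_sub]
    rfl
  rw [hTu, blochNorm, volterra_zero, enorm_zero, zero_add]
  refine iSup₂_le fun z hz => ?_
  have hz1 : ‖z‖ < 1 := by simpa using hz
  have h7 : 0 < 1 - ‖z‖ ^ 2 := by nlinarith [norm_nonneg z]
  rw [(hasDerivAt_volterra hg u.2.1.1 hz).deriv, norm_mul, ← ENNReal.ofReal_coe_nnreal,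
    ← ENNReal.ofReal_coe_nnreal, ← ENNReal.ofReal_mul b.coe_nonneg]
  refine ENNReal.ofReal_le_ofReal ?_
  change _ ≤ b * (2 * D)
  rcases le_or_gt ‖z‖ R with hzR | hzR
  · have h1 : ‖(u : ℂ → ℂ) z‖ ≤ ε := hf1 z hzR
    calc (1 - ‖z‖ ^ 2) * (‖(u : ℂ → ℂ) z‖ * ‖deriv g z‖)
        = ‖(u : ℂ → ℂ) z‖ * ((1 - ‖z‖ ^ 2) * ‖deriv g z‖) := by ring
      _ ≤ ε * (G + 1) := by
        gcongr
        linarith [hgG z hz1]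
      _ = b * (2 * D) := by rw [hε]; field_simp
  · have h1 : ‖(u : ℂ → ℂ) z‖ ≤ D * (1 - ‖z‖) ^ (-((1 - lam) / 2)) := hf2 z hz1
    have h2 := (hR z hzR hz1).le
    rw [blochMorreyWeight, ← ENNReal.ofReal_coe_nnreal] at h2
    replace h2 := (ENNReal.ofReal_le_ofReal_iff b.coe_nonneg).1 h2
    -- Passing from 1-|z| to 1-|z|² costs 2^{(1-λ)/2} ≤ 2, the source of the 2 in the constant 2D.
    have h3 : (1 - ‖z‖) ^ (-((1 - lam) / 2)) ≤ 2 * (1 - ‖z‖ ^ 2) ^ (-((1 - lam) / 2)) := by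
      have e0 : 0 < 1 - ‖z‖ := by linarith
      calc (1 - ‖z‖) ^ (-((1 - lam) / 2)) ≤ ((1 - ‖z‖ ^ 2) / 2) ^ (-((1 - lam) / 2)) :=
            Real.rpow_le_rpow_of_nonpos (by positivity) (by nlinarith [norm_nonneg z])
              (by linarith)
        _ = (1 - ‖z‖ ^ 2) ^ (-((1 - lam) / 2)) * 2 ^ ((1 - lam) / 2) := by
            rw [Real.div_rpow h7.le (by norm_num), Real.rpow_neg (by norm_num : (0 : ℝ) ≤ 2),
              div_inv_eq_mul]
        _ ≤ (1 - ‖z‖ ^ 2) ^ (-((1 - lam) / 2)) * 2 ^ (1 : ℝ) := by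
            gcongr
            · norm_num
            · linarith
        _ = _ := by rw [Real.rpow_one, mul_comm]
    have h4 : (1 - ‖z‖ ^ 2) ^ ((1 + lam) / 2) =
        (1 - ‖z‖ ^ 2) * (1 - ‖z‖ ^ 2) ^ (-((1 - lam) / 2)) := by
      conv_rhs => enter [1]; rw [← Real.rpow_one (1 - ‖z‖ ^ 2)]
      rw [← Real.rpow_add h7]
      ring_nf
    calc (1 - ‖z‖ ^ 2) * (‖(u : ℂ → ℂ) z‖ * ‖deriv g z‖)
        ≤ (1 - ‖z‖ ^ 2) * (D * (2 * (1 - ‖z‖ ^ 2) ^ (-((1 - lam) / 2))) * ‖deriv g z‖) := by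
          gcongr
          exact h1.trans (by gcongr)
      _ = 2 * D * ((1 - ‖z‖ ^ 2) ^ ((1 + lam) / 2) * ‖deriv g z‖) := by rw [h4]; ring
      _ ≤ 2 * D * b := by gcongr
      _ = b * (2 * D) := mul_comm _ _

/-! ### The two-sided estimate -/

theorem mainTheorem8 (lam p : ℝ) (hlam0 : 0 < lam) (hlam1 : lam < 1) (hp : 1 < p) :
    ∃ C : ℝ≥0, 0 < C ∧
      ∀ (g : ℂ → ℂ) (hg : DifferentiableOn ℂ g (Metric.ball 0 1))
        (hmap : ∀ f ∈ LittleMorrey lam, volterra g f ∈ LittleBloch),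
        opNormOf (morreyNorm lam) blochNorm (volterraOp lam hg hmap) < ∞ →
          essNormOf (morreyNorm lam) blochNorm (volterraOp lam hg hmap) ≤
              C * limsup (blochMorreyIntegral p lam g) toBoundary ∧
          limsup (blochMorreyIntegral p lam g) toBoundary ≤
              C * essNormOf (morreyNorm lam) blochNorm (volterraOp lam hg hmap) := by
  obtain ⟨C₁, hC₁, h₁⟩ := blochMorreyWeight_le_blochMorreyIntegral hlam0 hlam1 hp
  obtain ⟨C₂, hC₂, h₂⟩ := limsup_blochMorreyIntegral_le hlam0 hlam1 hp
  obtain ⟨C₃, hC₃, h₃⟩ := limsup_blochMorreyWeight_le_essNorm hlam0 hlam1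
  obtain ⟨C₄, hC₄, h₄⟩ := essNorm_le_limsup_blochMorreyWeight hlam0 hlam1
  refine ⟨max (C₄ * C₁) (C₂ * C₃), by positivity, fun g hg hmap _ => ⟨?_, ?_⟩⟩
  · have h : limsup (blochMorreyWeight lam g) toBoundary ≤
        C₁ * limsup (blochMorreyIntegral p lam g) toBoundary := by
      rw [← ENNReal.limsup_const_mul_of_ne_top ENNReal.coe_ne_top]
      refine limsup_le_limsup ?_
      filter_upwards [eventually_toBoundary_mem_ball] with a ha using h₁ g hg a ha
    calc _ ≤ C₄ * (C₁ * limsup (blochMorreyIntegral p lam g) toBoundary) :=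
          (h₄ g hg hmap).trans (by gcongr)
      _ = ((C₄ * C₁ : ℝ≥0) : ℝ≥0∞) * limsup (blochMorreyIntegral p lam g) toBoundary := by
          rw [ENNReal.coe_mul, mul_assoc]
      _ ≤ _ := by
          gcongr
          exact le_max_left _ _
  · calc _ ≤ C₂ * (C₃ * essNormOf (morreyNorm lam) blochNorm (volterraOp lam hg hmap)) :=
          (h₂ g hg).trans (by gcongr; exact h₃ g hg hmap)
      _ = ((C₂ * C₃ : ℝ≥0) : ℝ≥0∞) *
            essNormOf (morreyNorm lam) blochNorm (volterraOp lam hg hmap) := by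
          rw [ENNReal.coe_mul, mul_assoc]
      _ ≤ _ := by
          gcongr
          exact le_max_right _ _
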